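/- **Setting.** Let $X$ be a complex Hilbert space. For $d\in(0,\pi/2)$ let $$\mathcal D_d=\{z\in\mathbb C:\ |\arg(z+\sqrt{1+z^2})|<d\},$$ with principal branches; this is the image of the strip $\{|\operatorname{Im} w|<d\}$ under $\sinh$, and $\partial\mathcal D_r$ ($0<r<\pi/2$) consists of the curves $t\mapsto\sinh(t\pm \imath r)$, $t\in\mathbb R$. Let $\mathcal N_2(\mathcal D_d;X)$ be the set of all $F$ that are analytic in $\mathcal D_d$ with values in $X$ and satisfy $$\|F\|_{\mathcal N_2(\mathcal D_d;X)}:=\Big(\sup_{0<r<d}\int_{\partial\mathcal D_r}\|F(z)\|_X^2\,|\mathrm dz|\Big)^{1/2}<\infty,$$ that is, the boundary integral $\int_{\partial \mathcal D_d}\|F(z)\|_X^2\,|\mathrm dz|$ is understood in the Hardy space sense. For $x\in\mathbb R$ put $\phi(x)=\sinh^{-1}(x)=\log(x+\sqrt{1+x^2})$, and for $\vartheta>0$, $k\in\mathbb Z$ put $z_k=\sinh(k\vartheta)$ and $$\mathrm{Sinc}(k,\vartheta)(x)=\frac{\sin(\pi(x-k\vartheta)/\vartheta)}{\pi(x-k\vartheta)/\vartheta}\quad(\text{with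 value }1\text{ at }x=k\vartheta).$$ **Theorem.** There is a function $d\mapsto C(d)>0$ on $(0,\pi/2)$, depending only on $d$ (in particular not on $X$, $F$, $C$, $K$), with $C(d)\to\infty$ as $d\to0$, such that the following holds for every complex Hilbert space $X$ and every $d\in(0,\pi/2)$. Let $F\in\mathcal N_2(\mathcal D_d;X)$ and suppose that, for some $C>0$, $\|F(x)\|_X\le \frac{C}{\sqrt{1+x^2}}$ for all $x\in\mathbb R$. For each integer $K\ge1$ set $\vartheta=\left(\frac{2\pi d}{K}\right)^{1/2}$. Then $F-(\phi')^{1/2}\sum_{k=-K}^{K}\frac{F(z_k)}{\phi'(z_k)^{1/2}}\,\mathrm{Sinc}(k,\vartheta)\circ\phi$ belongs to $L^2(\mathbb R;X)$ and $$\Big\|F-(\phi')^{1/2}\sum_{k=-K}^{K}\frac{F(z_k)}{\phi'(z_k)^{1/2}}\,\mathrm{Sinc}(k,\vartheta)\circ\phi\Big\|_{L^2(\mathbb R;X)}\le C(d)\,K^{1/4}\exp\left(-\sqrt{\frac{\pi dK}{2}}\right)\big(\|F\|_{\mathcal N_2(\mathcal D_d;X)}+C\big).$$ -/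

import Mathlib

open scoped ENNReal

noncomputable section

namespace SincApprox

/-- The domain `D_d = {z : |arg (z + √(1 + z²))| < d}`, with principal branches of the
argument and of the square root. -/
def domain (d : ℝ) : Set ℂ :=
  {z : ℂ | |Complex.arg (z + (1 + z ^ 2) ^ (1 / 2 : ℂ))| < d}

/-- The curve `t ↦ sinh (t + i y)`. For `0 < r < π / 2` the boundary of `domain r` consists of the
two curves with `y = r` and `y = -r`. -/
def curve (y : ℝ) (t : ℝ) : ℂ := Complex.sinh ((t : ℂ) + (y : ℂ) * Complex.I)

/-- The arc length integral `∫_γ g(z) |dz|` of a nonnegative function along a curve `γ`. -/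
def arcLengthIntegral (γ : ℝ → ℂ) (g : ℂ → ℝ≥0∞) : ℝ≥0∞ :=
  ∫⁻ t : ℝ, g (γ t) * ‖deriv γ t‖ₑ

/-- `∫_{∂ D_r} ‖F(z)‖^p |dz|`. -/
def boundaryIntegral {X : Type*} [NormedAddCommGroup X] (p : ℝ) (r : ℝ) (F : ℂ → X) : ℝ≥0∞ :=
  arcLengthIntegral (curve r) (fun z => ‖F z‖ₑ ^ p) +
    arcLengthIntegral (curve (-r)) (fun z => ‖F z‖ₑ ^ p)

/-- The Hardy type norm `‖F‖_{N_p(D_d; X)}`. A member of the space is only given on the open set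
`D_d`, so the integral over `∂ D_d` is taken in the Hardy space sense, as the supremum of the
integrals over the boundaries `∂ D_r` with `0 < r < d`. -/
def hardyNorm {X : Type*} [NormedAddCommGroup X] (p : ℝ) (d : ℝ) (F : ℂ → X) : ℝ≥0∞ :=
  (⨆ r ∈ Set.Ioo (0 : ℝ) d, boundaryIntegral p r F) ^ (1 / p)

/-- Membership in `N_p(D_d; X)`: analytic in `D_d` and of finite norm. -/
def MemHardy {X : Type*} [NormedAddCommGroup X] [NormedSpace ℂ X] (p : ℝ) (d : ℝ)
    (F : ℂ → X) : Prop :=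
  AnalyticOnNhd ℂ F (domain d) ∧ hardyNorm p d F < ∞

/-- The conformal map `φ(x) = arsinh x = log (x + √(1 + x²))`, on the real line. -/
def phi (x : ℝ) : ℝ := Real.arsinh x

/-- The sinc points `z_k = sinh (k ϑ)`. -/
def sincPoint (θ : ℝ) (k : ℤ) : ℝ := Real.sinh ((k : ℝ) * θ)

/-- `Sinc(k, ϑ)(x) = sin (π (x - k ϑ) / ϑ) / (π (x - k ϑ) / ϑ)`, with value `1` at `x = k ϑ`. -/
def Sinc (k : ℤ) (θ : ℝ) (x : ℝ) : ℝ := Real.sinc (Real.pi * (x - (k : ℝ) * θ) / θ)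

/-- The truncated sinc interpolant
`(φ'(x))^{1/2} ∑_{k = -K}^{K} F(z_k) / φ'(z_k)^{1/2} · Sinc(k, ϑ)(φ(x))`. -/
def interpolant {X : Type*} [NormedAddCommGroup X] [NormedSpace ℂ X] (θ : ℝ) (K : ℕ)
    (F : ℂ → X) (x : ℝ) : X :=
  √(deriv phi x) • ∑ k ∈ Finset.Icc (-(K : ℤ)) (K : ℤ),
    (Sinc k θ (phi x) / √(deriv phi (sincPoint θ k))) • F ((sincPoint θ k : ℝ) : ℂ)

end SincApprox

end

/-!
Write `G(w) = cosh(w)^{1/2} F(sinh w)`, a Hardy function on the strip `|Im w| < d`, and `g = G|_ℝ`.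
The error is then the `L²` norm of `g - ∑_{|k| ≤ K} g(kθ) Sinc(k, θ)`.

For `0 < r < d`, Cauchy's formula writes `g` as a difference of Cauchy transforms of the
restrictions of `G` to the lines `Im w = ∓r`. By the partial fraction expansion of `1 / sin`, the
full sinc series of the Cauchy transform of `u` misses it by `sin(πt/θ)` times the Cauchy transform
of `u / sin(π(s ∓ ir)/θ)`, and the denominator is at least `sinh(πr/θ)` in modulus. The Cauchy
transforms `T_r` of level `r` are bounded on `L²` uniformly in `r`: the ranges of `T_r` and `T_{-r}`
are orthogonal, so `‖T_r u‖ ≤ ‖T_r u - T_{-r} u‖`, and `T_r - T_{-r}` is convolution with a Poisson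
kernel of mass `2π`. A Gaussian factor makes all these integrals absolutely convergent. This bounds
the error of the full series by a multiple of `1 / sinh(πd/θ)`.

The discarded terms form a geometric tail of size `exp(-Kθ/2) / √θ`, and `θ = √(2πd/K)` makes both
exponents equal to `√(πdK/2)`.
-/

namespace SincApprox

open MeasureTheory Filter Topology
open scoped Real
open Complex (I)

section Young

variable {α : Type*} [MeasurableSpace α] {μ : Measure α}

theorem sq_lintegral_mul_le {f g : α → ℝ≥0∞} (hf : AEMeasurable f μ) (hg : AEMeasurable g μ) :
    (∫⁻ a, f a * g a ∂μ) ^ 2 ≤ (∫⁻ a, f a ∂μ) * ∫⁻ a, f a * g a ^ 2 ∂μ := by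
  have sqrt_mul_self (x : ℝ≥0∞) : x ^ (1 / 2 : ℝ) * x ^ (1 / 2 : ℝ) = x := by
    rw [← ENNReal.rpow_add_of_nonneg _ _ (by norm_num) (by norm_num)]; norm_num
  have sq_sqrt (x : ℝ≥0∞) : (x ^ (1 / 2 : ℝ)) ^ (2 : ℝ) = x := by
    rw [← ENNReal.rpow_mul]; norm_num
  have holder := ENNReal.lintegral_mul_le_Lp_mul_Lq μ (p := 2) (q := 2)
    (by constructor <;> norm_num) (hf.pow_const (1 / 2 : ℝ)) ((hf.pow_const (1 / 2 : ℝ)).mul hg)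
  simp only [Pi.mul_apply, ← mul_assoc, sqrt_mul_self, sq_sqrt,
    ENNReal.mul_rpow_of_nonneg _ _ zero_le_two, ENNReal.rpow_two] at holder
  refine (pow_le_pow_left' holder 2).trans_eq ?_
  rw [mul_pow, ← ENNReal.rpow_two, ← ENNReal.rpow_two, sq_sqrt, sq_sqrt]

theorem eLpNorm_two_sq {E : Type*} [NormedAddCommGroup E] (f : α → E) :
    eLpNorm f 2 μ ^ 2 = ∫⁻ a, ‖f a‖ₑ ^ 2 ∂μ := by
  rw [eLpNorm_eq_lintegral_rpow_enorm_toReal two_ne_zero ENNReal.ofNat_ne_top,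
    ← ENNReal.rpow_two, ← ENNReal.rpow_mul]
  simp

theorem eLpNorm_two_le_iff {E : Type*} [NormedAddCommGroup E] {f : α → E} {c : ℝ≥0∞} :
    eLpNorm f 2 μ ≤ c ↔ ∫⁻ a, ‖f a‖ₑ ^ 2 ∂μ ≤ c ^ 2 := by
  rw [← eLpNorm_two_sq, ENNReal.pow_le_pow_left_iff two_ne_zero]

variable {𝕜 X : Type*} [NormedField 𝕜] [NormedAddCommGroup X] [NormedSpace ℝ X] [NormedSpace 𝕜 X]

theorem enorm_integral_smul_le (f : α → 𝕜) (u : α → X) :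
    ‖∫ a, f a • u a ∂μ‖ₑ ≤ ∫⁻ a, ‖f a‖ₑ * ‖u a‖ₑ ∂μ := by
  simpa only [enorm_smul] using enorm_integral_le_lintegral_enorm (μ := μ) fun a => f a • u a

variable {G : Type*} [AddCommGroup G] [MeasurableSpace G] [MeasurableAdd₂ G] [MeasurableNeg G]
  {ν : Measure G} [SFinite ν] {κ : G → 𝕜} {u : G → X}

theorem stronglyMeasurable_correlation (hκ : StronglyMeasurable κ) (hu : StronglyMeasurable u) :
    StronglyMeasurable fun t => ∫ s, κ (s - t) • u s ∂ν :=
  StronglyMeasurable.integral_prod_right' (f := fun p : G × G => κ (p.2 - p.1) • u p.2)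
    ((hκ.comp_measurable (measurable_snd.sub measurable_fst)).smul
      (hu.comp_measurable measurable_snd))

variable [ν.IsAddLeftInvariant] [ν.IsNegInvariant]

theorem lintegral_sq_correlation_le_left {f g : G → ℝ≥0∞} (hf : Measurable f)
    (hg : Measurable g) :
    ∫⁻ t, (∫⁻ s, f (s - t) * g s ∂ν) ^ 2 ∂ν ≤ (∫⁻ x, f x ∂ν) ^ 2 * ∫⁻ x, g x ^ 2 ∂ν := by
  calc ∫⁻ t, (∫⁻ s, f (s - t) * g s ∂ν) ^ 2 ∂ν
      ≤ ∫⁻ t, (∫⁻ x, f x ∂ν) * ∫⁻ s, f (s - t) * g s ^ 2 ∂ν ∂ν := by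
        refine lintegral_mono fun t => (sq_lintegral_mul_le (by fun_prop) (by fun_prop)).trans_eq ?_
        rw [lintegral_sub_right_eq_self f]
    _ = (∫⁻ x, f x ∂ν) * ∫⁻ s, ∫⁻ t, f (s - t) * g s ^ 2 ∂ν ∂ν := by
        rw [lintegral_const_mul, lintegral_lintegral_swap]
        · exact Measurable.aemeasurable (by fun_prop)
        · exact Measurable.lintegral_prod_right' (f := fun p : G × G => f (p.2 - p.1) * g p.2 ^ 2)
            (by fun_prop)
    _ = (∫⁻ x, f x ∂ν) * ∫⁻ s, (∫⁻ x, f x ∂ν) * g s ^ 2 ∂ν := by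
        congr 1
        refine lintegral_congr fun s => ?_
        rw [lintegral_mul_const _ (by fun_prop), lintegral_sub_left_eq_self f]
    _ = (∫⁻ x, f x ∂ν) ^ 2 * ∫⁻ x, g x ^ 2 ∂ν := by
        rw [lintegral_const_mul _ (by fun_prop), sq, mul_assoc]

theorem lintegral_sq_correlation_le_right {f g : G → ℝ≥0∞} (hf : Measurable f)
    (hg : Measurable g) :
    ∫⁻ t, (∫⁻ s, f (s - t) * g s ∂ν) ^ 2 ∂ν ≤ (∫⁻ x, g x ∂ν) ^ 2 * ∫⁻ x, f x ^ 2 ∂ν := by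
  have correlation_neg (t : G) : ∫⁻ s, f (s - t) * g s ∂ν = ∫⁻ s, g (s - -t) * f s ∂ν := by
    rw [← lintegral_add_right_eq_self _ t]
    simp only [add_sub_cancel_right, sub_neg_eq_add, mul_comm]
  simp only [correlation_neg]
  rw [lintegral_neg_eq_self fun t => (∫⁻ s, g (s - t) * f s ∂ν) ^ 2]
  exact lintegral_sq_correlation_le_left hg hf

theorem eLpNorm_correlation_le_left (hκ : StronglyMeasurable κ) (hu : StronglyMeasurable u) :
    eLpNorm (fun t => ∫ s, κ (s - t) • u s ∂ν) 2 ν ≤ (∫⁻ x, ‖κ x‖ₑ ∂ν) * eLpNorm u 2 ν := by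
  rw [eLpNorm_two_le_iff, mul_pow, eLpNorm_two_sq]
  exact (lintegral_mono fun t => pow_le_pow_left' (enorm_integral_smul_le _ u) 2).trans
    (lintegral_sq_correlation_le_left hκ.enorm hu.enorm)

theorem eLpNorm_correlation_le_right (hκ : StronglyMeasurable κ) (hu : StronglyMeasurable u) :
    eLpNorm (fun t => ∫ s, κ (s - t) • u s ∂ν) 2 ν ≤ (∫⁻ x, ‖u x‖ₑ ∂ν) * eLpNorm κ 2 ν := by
  rw [eLpNorm_two_le_iff, mul_pow, eLpNorm_two_sq]
  exact (lintegral_mono fun t => pow_le_pow_left' (enorm_integral_smul_le _ u) 2).trans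
    (lintegral_sq_correlation_le_right hκ.enorm hu.enorm)

theorem integrable_norm_mul_norm_sub_mul_norm {E F : Type*} [NormedAddCommGroup E]
    [NormedAddCommGroup F] {u : G → E} {v : G → F} (hu : Integrable u ν) (hκ : MemLp κ 2 ν)
    (hv : MemLp v 2 ν) :
    Integrable (fun p : G × G => ‖u p.1‖ * (‖κ (p.1 - p.2)‖ * ‖v p.2‖)) (ν.prod ν) := by
  have measurable : AEStronglyMeasurable (fun p : G × G => ‖u p.1‖ * (‖κ (p.1 - p.2)‖ * ‖v p.2‖))
      (ν.prod ν) :=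
    hu.1.norm.comp_fst.mul
      ((hκ.1.norm.comp_quasiMeasurePreserving (quasiMeasurePreserving_sub ν ν)).mul
        hv.1.norm.comp_snd)
  have cauchy_schwarz (s : G) :
      ∫⁻ t, ‖κ (s - t)‖ₑ * ‖v t‖ₑ ∂ν ≤ eLpNorm κ 2 ν * eLpNorm v 2 ν := by
    have measurePreserving := Measure.measurePreserving_sub_left ν s
    have holder := eLpNorm_smul_le_mul_eLpNorm (p := 2) (q := 2) (r := 1) hv.1.norm
      (hκ.1.norm.comp_measurePreserving measurePreserving)
    rw [eLpNorm_comp_measurePreserving hκ.1.norm measurePreserving, eLpNorm_norm, eLpNorm_norm,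
      eLpNorm_one_eq_lintegral_enorm] at holder
    simpa only [Pi.smul_apply', Function.comp_apply, enorm_smul, enorm_norm] using holder
  refine ⟨measurable, ?_⟩
  calc ∫⁻ p, ‖‖u p.1‖ * (‖κ (p.1 - p.2)‖ * ‖v p.2‖)‖ₑ ∂ν.prod ν
      = ∫⁻ s, ‖u s‖ₑ * ∫⁻ t, ‖κ (s - t)‖ₑ * ‖v t‖ₑ ∂ν ∂ν := by
        rw [lintegral_prod _ measurable.enorm]
        simp only [enorm_mul, enorm_norm]
        refine lintegral_congr fun s => lintegral_const_mul' _ _ enorm_ne_top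
    _ ≤ ∫⁻ s, ‖u s‖ₑ * (eLpNorm κ 2 ν * eLpNorm v 2 ν) ∂ν :=
        lintegral_mono fun s => mul_le_mul_right (cauchy_schwarz s) _
    _ = (∫⁻ s, ‖u s‖ₑ ∂ν) * (eLpNorm κ 2 ν * eLpNorm v 2 ν) :=
        lintegral_mul_const' _ _ (ENNReal.mul_ne_top hκ.2.ne hv.2.ne)
    _ < ∞ := ENNReal.mul_lt_top hu.2 (ENNReal.mul_lt_top hκ.2 hv.2)

end Young

section CauchyKernel

/-- The Cauchy kernel `x ↦ 1 / (x - i r)` on the real line. -/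
noncomputable def cauchyKernel (r x : ℝ) : ℂ := ((x : ℂ) - r * I)⁻¹

theorem ofReal_sub_mul_I_ne_zero {r : ℝ} (hr : r ≠ 0) (x : ℝ) : (x : ℂ) - r * I ≠ 0 := fun h =>
  hr (by simpa using congrArg Complex.im h)

variable {r : ℝ}

theorem continuous_cauchyKernel (hr : r ≠ 0) : Continuous (cauchyKernel r) := by
  unfold cauchyKernel
  exact Continuous.inv₀ (by fun_prop) (ofReal_sub_mul_I_ne_zero hr)

theorem norm_cauchyKernel_sq (r x : ℝ) : ‖cauchyKernel r x‖ ^ 2 = (x ^ 2 + r ^ 2)⁻¹ := by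
  rw [cauchyKernel, norm_inv, inv_pow, ← Complex.normSq_eq_norm_sq, Complex.normSq_apply]
  simp [sq]

theorem norm_cauchyKernel_le_inv_abs (hr : r ≠ 0) (x : ℝ) : ‖cauchyKernel r x‖ ≤ |r|⁻¹ := by
  rw [cauchyKernel, norm_inv]
  exact inv_anti₀ (abs_pos.2 hr) (by simpa using Complex.abs_im_le_norm ((x : ℂ) - r * I))

theorem tendsto_cauchyKernel_cocompact (r : ℝ) :
    Tendsto (cauchyKernel r) (cocompact ℝ) (𝓝 0) := by
  refine tendsto_inv₀_cobounded.comp (tendsto_norm_atTop_iff_cobounded.1 ?_)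
  refine tendsto_atTop_mono (fun x => ?_) (tendsto_norm_cocompact_atTop (E := ℝ))
  simpa using Complex.abs_re_le_norm ((x : ℂ) - r * I)

theorem conj_cauchyKernel (r x : ℝ) : (starRingEnd ℂ) (cauchyKernel r x) = cauchyKernel (-r) x := by
  simp [cauchyKernel]

theorem integrable_inv_sq_add_sq (hr : r ≠ 0) : Integrable fun x : ℝ => (x ^ 2 + r ^ 2)⁻¹ := by
  refine ((integrable_inv_one_add_sq.comp_div hr).const_mul (r ^ 2)⁻¹).congr
    (.of_forall fun x => ?_)
  simp only [← mul_inv]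
  congr 1
  field_simp
  ring

theorem integral_inv_sq_add_sq (hr : r ≠ 0) : ∫ x : ℝ, (x ^ 2 + r ^ 2)⁻¹ = π / |r| := by
  have scale (x : ℝ) : (x ^ 2 + r ^ 2)⁻¹ = (r ^ 2)⁻¹ * (1 + (x / r) ^ 2)⁻¹ := by
    rw [← mul_inv]
    congr 1
    field_simp
    ring
  simp_rw [scale]
  rw [integral_const_mul, Measure.integral_comp_div (fun x => (1 + x ^ 2)⁻¹),
    integral_univ_inv_one_add_sq, smul_eq_mul, ← sq_abs]
  have := abs_pos.2 hr
  field_simp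

theorem memLp_cauchyKernel (hr : r ≠ 0) : MemLp (cauchyKernel r) 2 volume := by
  rw [memLp_two_iff_integrable_sq_norm (continuous_cauchyKernel hr).aestronglyMeasurable]
  simpa only [norm_cauchyKernel_sq] using integrable_inv_sq_add_sq hr

theorem memLp_cauchyKernel_sub_left (hr : r ≠ 0) (s : ℝ) :
    MemLp (fun t => cauchyKernel r (s - t)) 2 volume :=
  (memLp_cauchyKernel hr).comp_measurePreserving (Measure.measurePreserving_sub_left volume s)

theorem cauchyKernel_sub_cauchyKernel_neg (hr : r ≠ 0) (x : ℝ) :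
    cauchyKernel r x - cauchyKernel (-r) x = ((2 * r * (x ^ 2 + r ^ 2)⁻¹ : ℝ) : ℂ) * I := by
  have factor : (x : ℂ) ^ 2 + r ^ 2 = ((x : ℂ) - r * I) * (x - (-r : ℝ) * I) := by
    push_cast; linear_combination (r : ℂ) ^ 2 * Complex.I_sq
  push_cast
  rw [factor, cauchyKernel, cauchyKernel, inv_sub_inv (ofReal_sub_mul_I_ne_zero hr x)
    (ofReal_sub_mul_I_ne_zero (neg_ne_zero.2 hr) x), div_eq_mul_inv]
  push_cast
  ring

theorem integrable_cauchyKernel_sub (hr : r ≠ 0) :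
    Integrable fun x => cauchyKernel r x - cauchyKernel (-r) x := by
  simp_rw [cauchyKernel_sub_cauchyKernel_neg hr]
  exact ((integrable_inv_sq_add_sq hr).const_mul _).ofReal.mul_const I

theorem integral_cauchyKernel_sub (hr : 0 < r) :
    ∫ x : ℝ, (cauchyKernel r x - cauchyKernel (-r) x) = 2 * π * I := by
  simp_rw [cauchyKernel_sub_cauchyKernel_neg hr.ne']
  rw [integral_mul_const, integral_complex_ofReal, integral_const_mul,
    integral_inv_sq_add_sq hr.ne', abs_of_pos hr]
  have : (r : ℂ) ≠ 0 := by exact_mod_cast hr.ne'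
  push_cast
  field_simp

theorem integral_norm_cauchyKernel_sub (hr : r ≠ 0) :
    ∫ x : ℝ, ‖cauchyKernel r x - cauchyKernel (-r) x‖ = 2 * π := by
  have norm_eq (x : ℝ) : ‖cauchyKernel r x - cauchyKernel (-r) x‖ =
      2 * |r| * (x ^ 2 + r ^ 2)⁻¹ := by
    rw [cauchyKernel_sub_cauchyKernel_neg hr, norm_mul, Complex.norm_I, mul_one,
      Complex.norm_real, Real.norm_eq_abs, abs_mul, abs_mul, abs_two,
      abs_of_nonneg (by positivity : 0 ≤ (x ^ 2 + r ^ 2)⁻¹)]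
  simp_rw [norm_eq]
  rw [integral_const_mul, integral_inv_sq_add_sq hr]
  field_simp [abs_ne_zero.2 hr]

theorem integral_comp_add_right_sub_self_eq_zero {E : Type*} [NormedAddCommGroup E]
    [NormedSpace ℝ E] [CompleteSpace E] {f : ℝ → E} {C h : ℝ} (hf : Continuous f)
    (bound : ∀ x, ‖f x‖ ≤ C) (lim : Tendsto f (cocompact ℝ) (𝓝 0))
    (integrable : Integrable fun x => f (x + h) - f x) : ∫ x, (f (x + h) - f x) = 0 := by
  have hasDerivAt (t : ℝ) : HasDerivAt (fun t => ∫ x in t..t + h, f x) (f (t + h) - f t) t := by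
    have primitive (a : ℝ) := intervalIntegral.integral_hasDerivAt_right
      (hf.intervalIntegrable 0 a) hf.aestronglyMeasurable.stronglyMeasurableAtFilter hf.continuousAt
    refine (((primitive (t + h)).comp_add_const t h).sub (primitive t)).congr_of_eventuallyEq
      (.of_forall fun x => ?_)
    exact (intervalIntegral.integral_interval_sub_left (hf.intervalIntegrable _ _)
      (hf.intervalIntegrable _ _)).symm
  have tendsto_zero {l : Filter ℝ} [l.IsCountablyGenerated]
      (hl : ∀ x, Tendsto (fun t => x + t) l (cocompact ℝ)) :
      Tendsto (fun t => ∫ x in t..t + h, f x) l (𝓝 0) := by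
    have translate (t : ℝ) : ∫ x in t..t + h, f x = ∫ x in (0)..h, f (x + t) := by
      rw [intervalIntegral.integral_comp_add_right, zero_add, add_comm]
    simp_rw [translate]
    simpa using intervalIntegral.tendsto_integral_filter_of_dominated_convergence (μ := volume)
      (a := 0) (b := h) (f := fun _ => (0 : E)) (fun _ => C)
      (.of_forall fun t => (by fun_prop : Continuous fun x => f (x + t)).aestronglyMeasurable)
      (.of_forall fun t => .of_forall fun x _ => bound _) intervalIntegrable_const
      (.of_forall fun x _ => lim.comp (hl x))
  rw [integral_of_hasDerivAt_of_tendsto hasDerivAt integrable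
    (tendsto_zero fun x => (tendsto_atBot_add_const_left _ x tendsto_id).mono_right
      atBot_le_cocompact)
    (tendsto_zero fun x => (tendsto_atTop_add_const_left _ x tendsto_id).mono_right
      atTop_le_cocompact), sub_zero]

theorem cauchyKernel_mul_cauchyKernel (hr : r ≠ 0) {x y : ℝ} (hxy : x ≠ y) :
    cauchyKernel r x * cauchyKernel r y =
      ((y - x : ℝ) : ℂ)⁻¹ * (cauchyKernel r x - cauchyKernel r y) := by
  have hx := ofReal_sub_mul_I_ne_zero hr x
  have hy := ofReal_sub_mul_I_ne_zero hr y
  have hyx : (y : ℂ) - x ≠ 0 := sub_ne_zero.2 (by exact_mod_cast hxy.symm)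
  rw [cauchyKernel, cauchyKernel, inv_sub_inv hx hy]
  push_cast
  field_simp
  ring

theorem integral_cauchyKernel_add_mul (hr : r ≠ 0) {h : ℝ} (hh : h ≠ 0) :
    ∫ x : ℝ, cauchyKernel r (x + h) * cauchyKernel r x = 0 := by
  have partial_fractions (x : ℝ) : cauchyKernel r (x + h) * cauchyKernel r x =
      ((-h : ℝ) : ℂ)⁻¹ * (cauchyKernel r (x + h) - cauchyKernel r x) := by
    rw [cauchyKernel_mul_cauchyKernel hr (by simpa using hh), sub_add_cancel_left]
  have integrable_mul : Integrable fun x => cauchyKernel r (x + h) * cauchyKernel r x :=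
    ((memLp_cauchyKernel hr).comp_measurePreserving
      (measurePreserving_add_right volume h)).integrable_mul (memLp_cauchyKernel hr)
  simp_rw [partial_fractions] at integrable_mul ⊢
  rw [integrable_const_mul_iff (isUnit_iff_ne_zero.2 (by simpa using hh))] at integrable_mul
  rw [integral_const_mul, integral_comp_add_right_sub_self_eq_zero (continuous_cauchyKernel hr)
    (norm_cauchyKernel_le_inv_abs hr) (tendsto_cauchyKernel_cocompact r) integrable_mul, mul_zero]

theorem integral_cauchyKernel_mul_cauchyKernel (hr : r ≠ 0) {s s' : ℝ} (hs : s ≠ s') :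
    ∫ t : ℝ, cauchyKernel r (s - t) * cauchyKernel r (s' - t) = 0 := by
  rw [← integral_sub_left_eq_self _ volume s',
    ← integral_cauchyKernel_add_mul hr (sub_ne_zero.2 hs)]
  refine integral_congr_ae (.of_forall fun x => ?_)
  ring_nf

end CauchyKernel

section CauchyTransform

/-- The Cauchy transform `t ↦ ∫ u(s) / (s - t - i r) ds` of a function `u` on the real line: the
Cauchy integral of `u` evaluated on the line `Im z = r`. -/
noncomputable def cauchyTransform {X : Type*} [NormedAddCommGroup X] [NormedSpace ℂ X] (r : ℝ)
    (u : ℝ → X) (t : ℝ) : X :=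
  ∫ s, cauchyKernel r (s - t) • u s

variable {r : ℝ}

section NormedSpace

variable {X : Type*} [NormedAddCommGroup X] [NormedSpace ℂ X] {u : ℝ → X}

theorem integrable_cauchyKernel_smul (hr : r ≠ 0) (hu : Integrable u) (t : ℝ) :
    Integrable fun s => cauchyKernel r (s - t) • u s :=
  hu.bdd_smul |r|⁻¹ ((continuous_cauchyKernel hr).comp
    (continuous_id.sub continuous_const)).aestronglyMeasurable
    (.of_forall fun _ => norm_cauchyKernel_le_inv_abs hr _)

theorem memLp_cauchyTransform (hr : r ≠ 0) (hu : StronglyMeasurable u) (hu' : Integrable u) :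
    MemLp (cauchyTransform r u) 2 volume := by
  have hκ := (continuous_cauchyKernel hr).stronglyMeasurable
  exact ⟨(stronglyMeasurable_correlation hκ hu).aestronglyMeasurable,
    (eLpNorm_correlation_le_right hκ hu).trans_lt
      (ENNReal.mul_lt_top hu'.2 (memLp_cauchyKernel hr).2)⟩

theorem cauchyTransform_sub_cauchyTransform_neg (hr : r ≠ 0) (hu : Integrable u) :
    cauchyTransform r u - cauchyTransform (-r) u =
      fun t => ∫ s, (cauchyKernel r (s - t) - cauchyKernel (-r) (s - t)) • u s := by
  ext t
  rw [Pi.sub_apply, cauchyTransform, cauchyTransform, ← integral_sub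
    (integrable_cauchyKernel_smul hr hu t) (integrable_cauchyKernel_smul (neg_ne_zero.2 hr) hu t)]
  simp only [sub_smul]

theorem eLpNorm_cauchyTransform_sub_cauchyTransform_neg_le (hr : r ≠ 0)
    (hu : StronglyMeasurable u) (hu' : Integrable u) :
    eLpNorm (cauchyTransform r u - cauchyTransform (-r) u) 2 volume ≤
      ENNReal.ofReal (2 * π) * eLpNorm u 2 volume := by
  have continuous_sub : Continuous fun x => cauchyKernel r x - cauchyKernel (-r) x :=
    (continuous_cauchyKernel hr).sub (continuous_cauchyKernel (neg_ne_zero.2 hr))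
  rw [cauchyTransform_sub_cauchyTransform_neg hr hu', ← integral_norm_cauchyKernel_sub hr,
    ofReal_integral_norm_eq_lintegral_enorm (integrable_cauchyKernel_sub hr)]
  exact eLpNorm_correlation_le_left (κ := fun x => cauchyKernel r x - cauchyKernel (-r) x)
    continuous_sub.stronglyMeasurable hu

theorem integral_cauchyKernel_smul_cauchyTransform [CompleteSpace X] (hr : r ≠ 0)
    (hu : Integrable u) (s : ℝ) :
    ∫ t, cauchyKernel r (s - t) • cauchyTransform r u t = 0 := by
  have hκ := continuous_cauchyKernel hr
  have integrable_prod : Integrable (Function.uncurry fun s' t : ℝ =>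
      cauchyKernel r (s - t) • cauchyKernel r (s' - t) • u s') (volume.prod volume) := by
    refine (integrable_norm_mul_norm_sub_mul_norm hu (memLp_cauchyKernel hr)
      (memLp_cauchyKernel_sub_left hr s)).mono'
      (.smul (Continuous.aestronglyMeasurable (by fun_prop))
        (.smul (Continuous.aestronglyMeasurable (by fun_prop)) hu.1.comp_fst))
      (.of_forall fun p => le_of_eq ?_)
    rw [Function.uncurry, norm_smul, norm_smul]
    ring
  calc ∫ t, cauchyKernel r (s - t) • cauchyTransform r u t
      = ∫ t, ∫ s', cauchyKernel r (s - t) • cauchyKernel r (s' - t) • u s' := by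
        simp only [cauchyTransform, integral_smul]
    _ = ∫ s', ∫ t, cauchyKernel r (s - t) • cauchyKernel r (s' - t) • u s' :=
        (integral_integral_swap integrable_prod).symm
    _ = ∫ _ : ℝ, (0 : X) := by
        refine integral_congr_ae ?_
        filter_upwards [compl_mem_ae_iff.2 (measure_singleton s)] with s' hs'
        simp only [← mul_smul]
        rw [integral_smul_const, integral_cauchyKernel_mul_cauchyKernel hr (Ne.symm hs'), zero_smul]
    _ = 0 := integral_zero _ _

end NormedSpace

variable {X : Type*} [NormedAddCommGroup X] [InnerProductSpace ℂ X]

theorem eLpNorm_le_eLpNorm_sub_of_integral_inner_eq_zero {α : Type*} [MeasurableSpace α]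
    {μ : Measure α} {f g : α → X} (hf : MemLp f 2 μ) (hg : MemLp g 2 μ)
    (orthogonal : ∫ a, inner ℂ (g a) (f a) ∂μ = 0) : eLpNorm f 2 μ ≤ eLpNorm (f - g) 2 μ := by
  have inner_toLp : inner ℂ hf.toLp hg.toLp = 0 := by
    rw [← inner_conj_symm, L2.inner_def, ← map_zero (starRingEnd ℂ), ← orthogonal]
    congr 1
    refine integral_congr_ae ?_
    filter_upwards [hf.coeFn_toLp, hg.coeFn_toLp] with a hfa hga
    rw [hfa, hga]
  have pythagoras := norm_sub_sq (𝕜 := ℂ) hf.toLp hg.toLp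
  rw [inner_toLp, ← MemLp.toLp_sub hf hg, Lp.norm_toLp, Lp.norm_toLp] at pythagoras
  simp only [map_zero, mul_zero, sub_zero] at pythagoras
  rw [← ENNReal.toReal_le_toReal hf.2.ne (hf.sub hg).2.ne,
    ← pow_le_pow_iff_left₀ ENNReal.toReal_nonneg ENNReal.toReal_nonneg two_ne_zero, pythagoras]
  exact le_add_of_nonneg_right (sq_nonneg _)

variable [CompleteSpace X] {u : ℝ → X}

theorem inner_cauchyTransform_neg (hr : r ≠ 0) (hu : Integrable u) (t : ℝ) (x : X) :
    inner ℂ (cauchyTransform (-r) u t) x =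
      ∫ s, inner ℂ (u s) (cauchyKernel r (s - t) • x) := by
  rw [← inner_conj_symm, cauchyTransform, ← integral_inner
    (integrable_cauchyKernel_smul (neg_ne_zero.2 hr) hu t), ← integral_conj]
  refine integral_congr_ae (.of_forall fun s => ?_)
  dsimp only
  rw [inner_conj_symm, inner_smul_left, inner_smul_right, conj_cauchyKernel, neg_neg]

theorem integral_inner_cauchyTransform_neg (hr : r ≠ 0) (hu : Integrable u) {v : ℝ → X}
    (hv : MemLp v 2 volume) :
    ∫ t, inner ℂ (cauchyTransform (-r) u t) (v t) =
      ∫ s, inner ℂ (u s) (∫ t, cauchyKernel r (s - t) • v t) := by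
  have hκ := continuous_cauchyKernel hr
  have integrable_prod : Integrable (Function.uncurry fun s t : ℝ =>
      inner ℂ (u s) (cauchyKernel r (s - t) • v t)) (volume.prod volume) := by
    refine (integrable_norm_mul_norm_sub_mul_norm hu (memLp_cauchyKernel hr) hv).mono'
      (hu.1.comp_fst.inner (.smul (Continuous.aestronglyMeasurable (by fun_prop)) hv.1.comp_snd))
      (.of_forall fun p => ?_)
    rw [← norm_smul]
    exact norm_inner_le_norm _ _
  simp_rw [inner_cauchyTransform_neg hr hu]
  rw [← integral_integral_swap integrable_prod]
  refine integral_congr_ae (.of_forall fun s => integral_inner ?_ _)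
  exact memLp_one_iff_integrable.1 (hv.smul (memLp_cauchyKernel_sub_left hr s))

theorem integral_inner_cauchyTransform_eq_zero (hr : r ≠ 0) (hu : StronglyMeasurable u)
    (hu' : Integrable u) :
    ∫ t, inner ℂ (cauchyTransform (-r) u t) (cauchyTransform r u t) = 0 := by
  rw [integral_inner_cauchyTransform_neg hr hu' (memLp_cauchyTransform hr hu hu')]
  simp only [integral_cauchyKernel_smul_cauchyTransform hr hu', inner_zero_right, integral_zero]

theorem eLpNorm_cauchyTransform_le (hr : r ≠ 0) (hu : StronglyMeasurable u) (hu' : Integrable u) :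
    eLpNorm (cauchyTransform r u) 2 volume ≤ ENNReal.ofReal (2 * π) * eLpNorm u 2 volume :=
  (eLpNorm_le_eLpNorm_sub_of_integral_inner_eq_zero (memLp_cauchyTransform hr hu hu')
    (memLp_cauchyTransform (neg_ne_zero.2 hr) hu hu')
    (integral_inner_cauchyTransform_eq_zero hr hu hu')).trans
    (eLpNorm_cauchyTransform_sub_cauchyTransform_neg_le hr hu hu')

end CauchyTransform

section Cosecant

theorem half_mem_integerComplement {z : ℂ} (hz : z ∈ Complex.integerComplement) :
    z / 2 ∈ Complex.integerComplement := by
  rw [Complex.mem_integerComplement_iff] at hz ⊢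
  rintro ⟨n, hn⟩
  exact hz ⟨2 * n, by push_cast; rw [hn]; ring⟩

theorem hasSum_cotTerm {z : ℂ} (hz : z ∈ Complex.integerComplement) :
    HasSum (cotTerm z) (π * Complex.cot (π * z) - 1 / z) := by
  rw [cot_series_rep' hz]
  exact (summable_cotTerm hz).hasSum

theorem cotTerm_two_mul_add_one (z : ℂ) (n : ℕ) :
    cotTerm z (2 * n + 1) = cotTerm (z / 2) n / 2 := by
  have sub_eq : z / 2 - (n + 1) = (z - ((2 * n + 1 : ℕ) + 1)) / 2 := by push_cast; ring
  have add_eq : z / 2 + (n + 1) = (z + ((2 * n + 1 : ℕ) + 1)) / 2 := by push_cast; ring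
  rw [cotTerm, cotTerm, sub_eq, add_eq, one_div_div, one_div_div]
  ring

theorem hasSum_cotTerm_odd {z : ℂ} (hz : z ∈ Complex.integerComplement) :
    HasSum (fun n => cotTerm z (2 * n + 1)) (π * Complex.cot (π * (z / 2)) / 2 - 1 / z) := by
  simp_rw [cotTerm_two_mul_add_one]
  have half := (hasSum_cotTerm (half_mem_integerComplement hz)).div_const 2
  rwa [one_div_div, sub_div, div_right_comm, div_self two_ne_zero] at half

theorem hasSum_cotTerm_even {z : ℂ} (hz : z ∈ Complex.integerComplement) :
    HasSum (fun n => cotTerm z (2 * n))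
      (π * Complex.cot (π * z) - π * Complex.cot (π * (z / 2)) / 2) := by
  have even : Summable fun n => cotTerm z (2 * n) :=
    (summable_cotTerm hz).comp_injective (mul_right_injective₀ two_ne_zero)
  convert even.hasSum
  rw [← sub_sub_sub_cancel_right _ _ (1 / z), sub_eq_iff_eq_add]
  exact (hasSum_cotTerm hz).unique (even.hasSum.even_add_odd (hasSum_cotTerm_odd hz))

theorem inv_sin_two_mul {x : ℂ} (hx : Complex.sin (2 * x) ≠ 0) :
    (Complex.sin (2 * x))⁻¹ = Complex.cot x - Complex.cot (2 * x) := by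
  rw [Complex.sin_two_mul] at hx
  have hsin : Complex.sin x ≠ 0 := fun h => hx (by rw [h, mul_zero, zero_mul])
  have hcos : Complex.cos x ≠ 0 := fun h => hx (by rw [h, mul_zero])
  rw [Complex.cot, Complex.cot, Complex.sin_two_mul, Complex.cos_two_mul]
  field_simp
  ring

theorem hasSum_cosecant {z : ℂ} (hz : z ∈ Complex.integerComplement) :
    HasSum (fun n => (-1 : ℂ) ^ (n + 1) * cotTerm z n) (π / Complex.sin (π * z) - 1 / z) := by
  have double : (π : ℂ) * z = 2 * (π * (z / 2)) := by ring
  have csc := inv_sin_two_mul (double ▸ sin_pi_mul_ne_zero hz)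
  rw [← double] at csc
  have alternate := HasSum.even_add_odd (f := fun n => (-1 : ℂ) ^ (n + 1) * cotTerm z n)
    (by simpa [pow_succ, pow_mul] using (hasSum_cotTerm_even hz).neg)
    (by simpa [pow_succ, pow_mul] using hasSum_cotTerm_odd hz)
  convert alternate using 1
  rw [div_eq_mul_inv, csc]
  ring

theorem sum_Icc_neg_eq_add_sum_range {M : Type*} [AddCommMonoid M] (f : ℤ → M) (n : ℕ) :
    ∑ k ∈ Finset.Icc (-(n : ℤ)) n, f k =
      f 0 + ∑ m ∈ Finset.range n, (f (m + 1) + f (-(m + 1))) := by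
  induction n with
  | zero => simp
  | succ n ih =>
    have insert_ends : Finset.Icc (-((n + 1 : ℕ) : ℤ)) ((n + 1 : ℕ) : ℤ) =
        insert ((n : ℤ) + 1) (insert (-((n : ℤ) + 1)) (Finset.Icc (-(n : ℤ)) n)) := by
      ext k
      simp only [Finset.mem_insert, Finset.mem_Icc]
      push_cast
      omega
    rw [insert_ends, Finset.sum_insert, Finset.sum_insert, ih, Finset.sum_range_succ]
    · abel
    · simp
    · simp only [Finset.mem_insert, Finset.mem_Icc]
      omega

theorem neg_one_zpow_neg {α : Type*} [DivisionRing α] (k : ℤ) : (-1 : α) ^ (-k) = (-1) ^ k := by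
  rw [zpow_neg, ← inv_zpow, inv_neg_one]

theorem tendsto_sum_cosecant {z : ℂ} (hz : z ∈ Complex.integerComplement) :
    Tendsto (fun n : ℕ => ∑ k ∈ Finset.Icc (-(n : ℤ)) n, (-1 : ℂ) ^ k / (z - k)) atTop
      (𝓝 (π / Complex.sin (π * z))) := by
  rw [← add_sub_cancel (1 / z) (_ / _)]
  refine ((hasSum_cosecant hz).tendsto_sum_nat.const_add (1 / z)).congr fun n => ?_
  rw [sum_Icc_neg_eq_add_sum_range]
  congr 1
  · simp
  · refine Finset.sum_congr rfl fun m _ => ?_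
    have pow_eq : (-1 : ℂ) ^ ((m : ℤ) + 1) = (-1) ^ (m + 1) := by exact_mod_cast rfl
    rw [neg_one_zpow_neg, pow_eq, cotTerm]
    push_cast
    rw [sub_neg_eq_add]
    ring

end Cosecant

section Sinc

variable {θ : ℝ}

theorem Sinc_of_ne (hθ : θ ≠ 0) {k : ℤ} {t : ℝ} (ht : t ≠ k * θ) :
    Sinc k θ t = Real.sin (π * t / θ) / π * ((-1) ^ k / (t / θ - k)) := by
  have sub_ne_zero : t - k * θ ≠ 0 := sub_ne_zero.2 ht
  have shift : π * (t - k * θ) / θ = π * t / θ - k * π := by field_simp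
  rw [Sinc, Real.sinc_of_ne_zero (by positivity), shift, Real.sin_sub_int_mul_pi]
  field_simp

theorem div_mem_integerComplement (hθ : θ ≠ 0) {w : ℂ} (hw : ∀ k : ℤ, w ≠ k * θ) :
    w / θ ∈ Complex.integerComplement := by
  rw [Complex.mem_integerComplement_iff]
  rintro ⟨k, hk⟩
  exact hw k ((eq_div_iff (Complex.ofReal_ne_zero.2 hθ)).1 hk).symm

theorem ne_ofReal_of_im_ne_zero {w : ℂ} (hw : w.im ≠ 0) (x : ℝ) : w ≠ x :=
  fun h => hw (h ▸ Complex.ofReal_im x)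

theorem Sinc_mul_inv_sub (hθ : θ ≠ 0) {k : ℤ} {t : ℝ} (ht : t ≠ k * θ) {w : ℂ}
    (hw : w.im ≠ 0) :
    (Sinc k θ t : ℂ) * (w - (k * θ : ℝ))⁻¹ =
      Real.sin (π * t / θ) / π * (w - t)⁻¹ *
        ((-1) ^ k / ((t / θ : ℝ) - k) - (-1) ^ k / (w / θ - k)) := by
  have hθ' : (θ : ℂ) ≠ 0 := Complex.ofReal_ne_zero.2 hθ
  have hwt : (w - k * θ) - (t - k * θ) ≠ 0 := by
    simpa using sub_ne_zero.2 (ne_ofReal_of_im_ne_zero hw t)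
  have hwk : w - k * θ ≠ 0 := by
    simpa using sub_ne_zero.2 (ne_ofReal_of_im_ne_zero hw (k * θ))
  have htk : (t : ℂ) - k * θ ≠ 0 := by exact_mod_cast sub_ne_zero.2 ht
  have scale (z : ℂ) : z / θ - k = (z - k * θ) / θ := by field_simp
  rw [Sinc_of_ne hθ ht, ← sub_sub_sub_cancel_right w t ((k : ℂ) * θ)]
  push_cast
  rw [scale, scale]
  generalize w - k * θ = b at *
  generalize (t : ℂ) - k * θ = a at *
  field_simp

theorem tendsto_sum_Sinc_mul_inv_sub (hθ : θ ≠ 0) {t : ℝ} (ht : ∀ k : ℤ, t ≠ k * θ) {w : ℂ}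
    (hw : w.im ≠ 0) :
    Tendsto
      (fun n : ℕ => ∑ k ∈ Finset.Icc (-(n : ℤ)) n, (Sinc k θ t : ℂ) * (w - (k * θ : ℝ))⁻¹) atTop
      (𝓝 ((1 - Real.sin (π * t / θ) / Complex.sin (π * w / θ)) * (w - t)⁻¹)) := by
  have t_mem : ((t / θ : ℝ) : ℂ) ∈ Complex.integerComplement := by
    rw [Complex.ofReal_div]
    exact div_mem_integerComplement hθ fun k => by exact_mod_cast ht k
  have w_mem : w / θ ∈ Complex.integerComplement :=
    div_mem_integerComplement hθ fun k => by
      simpa using ne_ofReal_of_im_ne_zero hw (k * θ)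
  have limit := ((tendsto_sum_cosecant t_mem).sub (tendsto_sum_cosecant w_mem)).const_mul
    (Real.sin (π * t / θ) / π * (w - t)⁻¹)
  convert limit using 1
  · ext n
    rw [← Finset.sum_sub_distrib, Finset.mul_sum]
    exact Finset.sum_congr rfl fun k _ => Sinc_mul_inv_sub hθ (ht k) hw
  · have sin_t_ne_zero := sin_pi_mul_ne_zero t_mem
    have pi_ne_zero : (π : ℂ) ≠ 0 := Complex.ofReal_ne_zero.2 Real.pi_ne_zero
    have sin_t_eq : (Real.sin (π * t / θ) : ℂ) = Complex.sin (π * (t / θ : ℝ)) := by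
      push_cast
      rw [mul_div_assoc]
    rw [mul_div_assoc _ w, sin_t_eq]
    field_simp

theorem sinc_sq_le (x : ℝ) : Real.sinc x ^ 2 ≤ 2 * (x ^ 2 + 1)⁻¹ := by
  have sq_le_one : Real.sinc x ^ 2 ≤ 1 := (sq_le_one_iff_abs_le_one _).2 (Real.abs_sinc_le_one x)
  have sq_mul_sq_le_one : Real.sinc x ^ 2 * x ^ 2 ≤ 1 := by
    rcases eq_or_ne x 0 with rfl | hx
    · simp
    · rw [Real.sinc_of_ne_zero hx, div_pow, div_mul_cancel₀ _ (by positivity)]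
      exact Real.sin_sq_le_one x
  rw [← div_eq_mul_inv, le_div_iff₀ (by positivity)]
  linarith

theorem Sinc_sq_le (hθ : θ ≠ 0) (k : ℤ) (t : ℝ) :
    Sinc k θ t ^ 2 ≤ 2 * (θ / π) ^ 2 * ((t - k * θ) ^ 2 + (θ / π) ^ 2)⁻¹ := by
  refine (sinc_sq_le _).trans_eq ?_
  have : 0 < (t - k * θ) ^ 2 + (θ / π) ^ 2 := by positivity
  field_simp

theorem continuous_Sinc (k : ℤ) (θ : ℝ) : Continuous (Sinc k θ) := by
  unfold Sinc
  exact Real.continuous_sinc.comp (by fun_prop)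

theorem eLpNorm_Sinc_le (hθ : 0 < θ) (k : ℤ) :
    eLpNorm (Sinc k θ) 2 volume ≤ ENNReal.ofReal √(2 * θ) := by
  have hθπ : 0 < θ / π := div_pos hθ Real.pi_pos
  have integrable := ((integrable_inv_sq_add_sq hθπ.ne').comp_sub_right (k * θ)).const_mul
    (2 * (θ / π) ^ 2)
  rw [eLpNorm_two_le_iff]
  calc ∫⁻ t, ‖Sinc k θ t‖ₑ ^ 2
      ≤ ∫⁻ t, ENNReal.ofReal (2 * (θ / π) ^ 2 * ((t - k * θ) ^ 2 + (θ / π) ^ 2)⁻¹) := by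
        refine lintegral_mono fun t => ?_
        rw [Real.enorm_eq_ofReal_abs, ← ENNReal.ofReal_pow (abs_nonneg _), sq_abs]
        exact ENNReal.ofReal_le_ofReal (Sinc_sq_le hθ.ne' k t)
    _ = ENNReal.ofReal (2 * (θ / π) ^ 2 * (π / (θ / π))) := by
        rw [← ofReal_integral_eq_lintegral_ofReal integrable (.of_forall fun t => by positivity),
          integral_const_mul, integral_sub_right_eq_self fun t => (t ^ 2 + (θ / π) ^ 2)⁻¹,
          integral_inv_sq_add_sq hθπ.ne', abs_of_pos hθπ]
    _ = ENNReal.ofReal √(2 * θ) ^ 2 := by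
        rw [← ENNReal.ofReal_pow (Real.sqrt_nonneg _), Real.sq_sqrt (by positivity)]
        field_simp

theorem summable_inv_one_add_int_sq : Summable fun j : ℤ => (1 + (j : ℝ) ^ 2)⁻¹ := by
  refine .of_norm_bounded_eventually (Real.summable_one_div_int_pow.2 one_lt_two) ?_
  filter_upwards [(Set.finite_singleton (0 : ℤ)).compl_mem_cofinite] with j (hj : j ≠ 0)
  rw [Real.norm_of_nonneg (by positivity), one_div]
  exact inv_anti₀ (by positivity) (by linarith)

theorem one_add_sub_floor_sq_le {r : ℝ} (hθ : θ ≠ 0) (hr : r ≠ 0) (s : ℝ) (k : ℤ) :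
    1 + ((k - ⌊s / θ⌋ : ℤ) : ℝ) ^ 2 ≤ (2 / θ ^ 2 + 3 / r ^ 2) * ((s - k * θ) ^ 2 + r ^ 2) := by
  set v := s / θ - k
  have sub_eq : s - k * θ = θ * v := by simp only [v]; field_simp
  have fract_sq_le : Int.fract (s / θ) ^ 2 ≤ 1 :=
    pow_le_one₀ (Int.fract_nonneg _) (Int.fract_lt_one _).le
  have floor_sub : ((k - ⌊s / θ⌋ : ℤ) : ℝ) = Int.fract (s / θ) - v := by
    simp only [v, Int.fract]
    push_cast
    ring
  have expand : (2 / θ ^ 2 + 3 / r ^ 2) * ((s - k * θ) ^ 2 + r ^ 2) =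
      2 * v ^ 2 + 3 + (2 * r ^ 2 / θ ^ 2 + 3 * (θ * v) ^ 2 / r ^ 2) := by
    rw [sub_eq]
    field_simp
    ring
  have cross_terms_nonneg : 0 ≤ 2 * r ^ 2 / θ ^ 2 + 3 * (θ * v) ^ 2 / r ^ 2 := by positivity
  rw [expand, floor_sub]
  nlinarith [sq_nonneg (Int.fract (s / θ) + v)]

theorem exists_forall_sum_inv_sq_add_sq_le {r : ℝ} (hθ : θ ≠ 0) (hr : r ≠ 0) :
    ∃ M : ℝ, ∀ (s : ℝ) (S : Finset ℤ), ∑ k ∈ S, ((s - k * θ) ^ 2 + r ^ 2)⁻¹ ≤ M := by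
  set A := 2 / θ ^ 2 + 3 / r ^ 2
  refine ⟨A * ∑' j : ℤ, (1 + (j : ℝ) ^ 2)⁻¹, fun s S => ?_⟩
  set m : ℤ := ⌊s / θ⌋
  have term_le (k : ℤ) :
      ((s - k * θ) ^ 2 + r ^ 2)⁻¹ ≤ A * (1 + ((k - m : ℤ) : ℝ) ^ 2)⁻¹ := by
    rw [← div_eq_mul_inv, inv_eq_one_div, div_le_div_iff₀ (by positivity) (by positivity), one_mul]
    exact one_add_sub_floor_sq_le hθ hr s k
  calc ∑ k ∈ S, ((s - k * θ) ^ 2 + r ^ 2)⁻¹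
      ≤ ∑ k ∈ S, A * (1 + ((k - m : ℤ) : ℝ) ^ 2)⁻¹ := Finset.sum_le_sum fun k _ => term_le k
    _ ≤ A * ∑' k : ℤ, (1 + ((k - m : ℤ) : ℝ) ^ 2)⁻¹ := by
        rw [← Finset.mul_sum]
        refine mul_le_mul_of_nonneg_left (Summable.sum_le_tsum S (fun _ _ => by positivity) ?_)
          (by positivity)
        exact summable_inv_one_add_int_sq.comp_injective sub_left_injective
    _ = A * ∑' j : ℤ, (1 + (j : ℝ) ^ 2)⁻¹ :=
        congrArg (A * ·) ((Equiv.subRight m).tsum_eq fun j : ℤ => (1 + (j : ℝ) ^ 2)⁻¹)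

theorem exists_forall_norm_sum_Sinc_mul_cauchyKernel_le {r : ℝ} (hθ : θ ≠ 0) (hr : r ≠ 0)
    (t : ℝ) :
    ∃ M : ℝ, ∀ (s : ℝ) (S : Finset ℤ),
      ‖∑ k ∈ S, (Sinc k θ t : ℂ) * cauchyKernel r (s - k * θ)‖ ≤ M := by
  obtain ⟨M₁, sum_kernel_le⟩ := exists_forall_sum_inv_sq_add_sq_le hθ hr
  obtain ⟨M₂, sum_sinc_le⟩ :=
    exists_forall_sum_inv_sq_add_sq_le hθ (div_ne_zero hθ Real.pi_ne_zero)
  refine ⟨2 * (θ / π) ^ 2 * M₂ + M₁, fun s S => ?_⟩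
  have term_le (k : ℤ) : ‖(Sinc k θ t : ℂ) * cauchyKernel r (s - k * θ)‖ ≤
      2 * (θ / π) ^ 2 * ((t - k * θ) ^ 2 + (θ / π) ^ 2)⁻¹ + ((s - k * θ) ^ 2 + r ^ 2)⁻¹ := by
    rw [norm_mul, Complex.norm_real, Real.norm_eq_abs, ← norm_cauchyKernel_sq r (s - k * θ)]
    have sinc_le := Sinc_sq_le hθ k t
    rw [← sq_abs] at sinc_le
    nlinarith [two_mul_le_add_sq |Sinc k θ t| ‖cauchyKernel r (s - k * θ)‖,
      abs_nonneg (Sinc k θ t), norm_nonneg (cauchyKernel r (s - k * θ))]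
  refine (norm_sum_le _ _).trans ((Finset.sum_le_sum fun k _ => term_le k).trans ?_)
  rw [Finset.sum_add_distrib, ← Finset.mul_sum]
  exact add_le_add (mul_le_mul_of_nonneg_left (sum_sinc_le t S) (by positivity)) (sum_kernel_le s S)

variable {X : Type*} [NormedAddCommGroup X] [NormedSpace ℝ X]

/-- The truncated sinc series `∑_{|k| ≤ K} g(kθ) Sinc(k, θ)` of `g` on the grid `θℤ`. -/
noncomputable def sincSum (θ : ℝ) (K : ℕ) (g : ℝ → X) (t : ℝ) : X :=
  ∑ k ∈ Finset.Icc (-(K : ℤ)) K, Sinc k θ t • g (k * θ)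

/-- The sum `∑_{|k| > K} ‖g(kθ)‖` of the samples discarded by `sincSum θ K g`; the terms
`k = ±(K + n + 1)` are grouped together. -/
noncomputable def sampleTail {E : Type*} [NormedAddCommGroup E] (θ : ℝ) (K : ℕ) (g : ℝ → E) :
    ℝ≥0∞ :=
  ∑' n : ℕ, (‖g ((K + n + 1) * θ)‖ₑ + ‖g (-(K + n + 1) * θ)‖ₑ)

theorem continuous_sincSum (θ : ℝ) (K : ℕ) (g : ℝ → X) : Continuous (sincSum θ K g) := by
  unfold sincSum
  exact continuous_finsetSum _ fun k _ => (continuous_Sinc k θ).smul continuous_const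

theorem sincSum_add_sub_sincSum (θ : ℝ) (K n : ℕ) (g : ℝ → X) :
    sincSum θ (K + n) g - sincSum θ K g = ∑ m ∈ Finset.range n, fun t =>
      Sinc (K + m + 1) θ t • g ((K + m + 1) * θ) +
        Sinc (-(K + m + 1)) θ t • g (-(K + m + 1) * θ) := by
  ext t
  simp only [Pi.sub_apply, sincSum, sum_Icc_neg_eq_add_sum_range, Finset.sum_range_add,
    Finset.sum_apply]
  push_cast
  abel

theorem eLpNorm_Sinc_smul_le (hθ : 0 < θ) (k : ℤ) (x : X) :
    eLpNorm (fun t => Sinc k θ t • x) 2 volume ≤ ENNReal.ofReal √(2 * θ) * ‖x‖ₑ := by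
  rw [mul_comm, ← ofReal_norm]
  refine (eLpNorm_le_mul_eLpNorm_of_ae_le_mul (.of_forall fun t => ?_) 2).trans
    (mul_le_mul_right (eLpNorm_Sinc_le hθ k) _)
  rw [norm_smul, mul_comm]

theorem eLpNorm_sincSum_add_sub_sincSum_le (hθ : 0 < θ) (K n : ℕ) (g : ℝ → X) :
    eLpNorm (sincSum θ (K + n) g - sincSum θ K g) 2 volume ≤
      ENNReal.ofReal √(2 * θ) * sampleTail θ K g := by
  have measurable (k : ℤ) (x : X) : AEStronglyMeasurable (fun t => Sinc k θ t • x) volume :=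
    ((continuous_Sinc k θ).smul continuous_const).aestronglyMeasurable
  rw [sincSum_add_sub_sincSum, sampleTail, ← ENNReal.tsum_mul_left]
  refine (eLpNorm_sum_le (fun m _ => (measurable _ _).add (measurable _ _)) one_le_two).trans
    ((Finset.sum_le_sum fun m _ => ?_).trans (ENNReal.sum_le_tsum (Finset.range n)))
  rw [mul_add]
  exact (eLpNorm_add_le (measurable _ _) (measurable _ _) one_le_two).trans
    (add_le_add (eLpNorm_Sinc_smul_le hθ _ _) (eLpNorm_Sinc_smul_le hθ _ _))

theorem eLpNorm_sub_sincSum_le_sampleTail (hθ : 0 < θ) (K : ℕ) {g f : ℝ → X}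
    (hf : ∀ᵐ t, Tendsto (fun n : ℕ => sincSum θ n g t) atTop (𝓝 (f t))) :
    eLpNorm (f - sincSum θ K g) 2 volume ≤ ENNReal.ofReal √(2 * θ) * sampleTail θ K g := by
  refine (Lp.eLpNorm_lim_le_liminf_eLpNorm (f := fun n => sincSum θ (K + n) g - sincSum θ K g)
    (fun n => ((continuous_sincSum _ _ _).sub (continuous_sincSum _ _ _)).aestronglyMeasurable)
    _ ?_).trans ?_
  · filter_upwards [hf] with t ht
    exact (ht.comp (tendsto_atTop_mono (Nat.le_add_left · K) tendsto_id)).sub_const _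
  · refine (liminf_le_liminf (.of_forall fun n =>
      eLpNorm_sincSum_add_sub_sincSum_le hθ K n g)).trans_eq (liminf_const _)

end Sinc

section Strip

/-- The open horizontal strip `|Im w| < d`. -/
def strip (d : ℝ) : Set ℂ := {w : ℂ | |w.im| < d}

theorem isOpen_strip (d : ℝ) : IsOpen (strip d) :=
  isOpen_lt Complex.continuous_im.abs continuous_const

theorem add_mul_I_mem_strip {d y : ℝ} (hy : |y| < d) (x : ℝ) : (x : ℂ) + y * I ∈ strip d := by
  simpa [strip] using hy

theorem ofReal_mem_strip {d : ℝ} (hd : 0 < d) (x : ℝ) : (x : ℂ) ∈ strip d := by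
  simpa [strip] using hd

theorem frequently_atTop_le_and_neg_le {V : ℝ → ℝ≥0∞} {ε : ℝ≥0∞} (hε : ε ≠ 0)
    (hV : AEMeasurable V volume) (hV' : ∫⁻ x, V x ≠ ∞) :
    ∃ᶠ x in atTop, V x ≤ ε ∧ V (-x) ≤ ε := by
  rw [frequently_atTop']
  intro a
  by_contra! large
  have superlevel_lt_top : volume {x | ε ≤ V x} < ∞ :=
    ENNReal.lt_top_of_mul_ne_top_right
      ((mul_meas_ge_le_lintegral₀ hV ε).trans_lt hV'.lt_top).ne hε
  have Ioi_subset : Set.Ioi a ⊆ {x | ε ≤ V x} ∪ Neg.neg ⁻¹' {x | ε ≤ V x} := fun x hx =>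
    or_iff_not_imp_left.2 fun hVx => (large x hx (not_le.1 hVx).le).le
  have volume_Ioi_le := (measure_mono (μ := volume) Ioi_subset).trans (measure_union_le _ _)
  rw [Measure.measure_preimage_neg, Real.volume_Ioi] at volume_Ioi_le
  exact volume_Ioi_le.not_gt (ENNReal.add_lt_top.2 ⟨superlevel_lt_top, superlevel_lt_top⟩)

variable {X : Type*}

/-- The restriction `s ↦ G (s + i y)` of `G` to the horizontal line at height `y`. -/
def restrictLine (y : ℝ) (G : ℂ → X) (s : ℝ) : X := G (s + y * I)

theorem restrictLine_zero (G : ℂ → X) (s : ℝ) : restrictLine 0 G s = G s := by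
  simp [restrictLine]

variable [NormedAddCommGroup X] {d r : ℝ} {G : ℂ → X}

theorem continuous_restrictLine {y : ℝ} (hG : ContinuousOn G (strip d)) (hy : |y| < d) :
    Continuous (restrictLine y G) :=
  hG.comp_continuous (by fun_prop) (add_mul_I_mem_strip hy)

/-- The integral of `‖G‖` over the vertical segment from `a - i r` to `a + i r`. -/
noncomputable def verticalIntegral (r : ℝ) (G : ℂ → X) (a : ℝ) : ℝ≥0∞ :=
  ∫⁻ y in Set.Ioc (-r) r, ‖G (a + y * I)‖ₑ

theorem aemeasurable_enorm_add_mul_I (hrd : r < d) (hG : ContinuousOn G (strip d)) :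
    AEMeasurable (Function.uncurry fun x y : ℝ => ‖G (x + y * I)‖ₑ)
      (volume.prod (volume.restrict (Set.Ioc (-r) r))) := by
  have prod_restrict : (volume : Measure ℝ).prod (volume.restrict (Set.Ioc (-r) r)) =
      ((volume : Measure ℝ).prod volume).restrict (Set.univ ×ˢ Set.Ioc (-r) r) := by
    rw [← Measure.prod_restrict, Measure.restrict_univ]
  rw [prod_restrict]
  refine ContinuousOn.aemeasurable ?_ (MeasurableSet.univ.prod measurableSet_Ioc)
  refine ContinuousOn.enorm (hG.comp (by fun_prop) fun p hp => ?_)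
  exact add_mul_I_mem_strip ((abs_le.2 ⟨hp.2.1.le, hp.2.2⟩).trans_lt hrd) _

theorem lintegral_verticalIntegral_ne_top (hrd : r < d) (hG : ContinuousOn G (strip d))
    {B : ℝ≥0∞} (hB : B ≠ ∞) (bound : ∀ y, y ≠ 0 → |y| ≤ r → ∫⁻ s, ‖restrictLine y G s‖ₑ ≤ B) :
    ∫⁻ a, verticalIntegral r G a ≠ ∞ := by
  simp only [verticalIntegral]
  rw [lintegral_lintegral_swap (aemeasurable_enorm_add_mul_I hrd hG)]
  have ae_bound : ∀ᵐ y : ℝ ∂volume.restrict (Set.Ioc (-r) r), ∫⁻ s, ‖restrictLine y G s‖ₑ ≤ B := by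
    filter_upwards [ae_restrict_of_ae (compl_mem_ae_iff.2 (measure_singleton 0)),
      ae_restrict_mem measurableSet_Ioc] with y hy0 hy
    exact bound y hy0 (abs_le.2 ⟨hy.1.le, hy.2⟩)
  refine ((lintegral_mono_ae ae_bound).trans_lt ?_).ne
  rw [setLIntegral_const, Real.volume_Ioc]
  exact ENNReal.mul_lt_top hB.lt_top ENNReal.ofReal_lt_top

variable [NormedSpace ℂ X]

theorem intervalIntegral_restrictLine_sub (hr : 0 < r) (hrd : r < d)
    (hG : DifferentiableOn ℂ G (strip d)) (a b : ℝ) :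
    ∫ x in a..b, (restrictLine (-r) G x - restrictLine r G x) =
      I • (∫ y in (-r)..r, G (a + y * I)) - I • ∫ y in (-r)..r, G (b + y * I) := by
  have rectangle_subset : Set.uIcc a b ×ℂ Set.uIcc (-r) r ⊆ strip d := fun w hw => by
    have := (Complex.mem_reProdIm.1 hw).2
    rw [Set.uIcc_of_le (by linarith)] at this
    exact (abs_le.2 this).trans_lt hrd
  have cauchy := Complex.integral_boundary_rect_eq_zero_of_differentiableOn G
    ⟨a, -r⟩ ⟨b, r⟩ (hG.mono rectangle_subset)
  dsimp only at cauchy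
  rw [sub_eq_zero, add_comm, ← eq_sub_iff_add_eq'] at cauchy
  have abs_r : |r| < d := by rwa [abs_of_pos hr]
  rw [intervalIntegral.integral_sub]
  · exact cauchy
  · exact (continuous_restrictLine hG.continuousOn (by rwa [abs_neg])).intervalIntegrable _ _
  · exact (continuous_restrictLine hG.continuousOn abs_r).intervalIntegrable _ _

theorem enorm_intervalIntegral_restrictLine_sub_le (hr : 0 < r) (hrd : r < d)
    (hG : DifferentiableOn ℂ G (strip d)) (a b : ℝ) :
    ‖∫ x in a..b, (restrictLine (-r) G x - restrictLine r G x)‖ₑ ≤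
      verticalIntegral r G a + verticalIntegral r G b := by
  have side (x : ℝ) : ‖I • ∫ y in (-r)..r, G (x + y * I)‖ₑ ≤ verticalIntegral r G x := by
    rw [enorm_smul, ← ofReal_norm, Complex.norm_I, ENNReal.ofReal_one, one_mul,
      intervalIntegral.integral_of_le (by linarith)]
    exact enorm_integral_le_lintegral_enorm _
  rw [intervalIntegral_restrictLine_sub hr hrd hG]
  exact enorm_sub_le.trans (add_le_add (side a) (side b))

theorem integral_restrictLine_sub_eq_zero (hr : 0 < r) (hrd : r < d)
    (hG : DifferentiableOn ℂ G (strip d))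
    (integrable : Integrable fun x => restrictLine (-r) G x - restrictLine r G x)
    {l : Filter ℝ} [l.NeBot] [l.IsCountablyGenerated] (hl : l ≤ atTop)
    (left : Tendsto (fun R => verticalIntegral r G (-R)) l (𝓝 0))
    (right : Tendsto (verticalIntegral r G) l (𝓝 0)) :
    ∫ x, (restrictLine (-r) G x - restrictLine r G x) = 0 := by
  refine tendsto_nhds_unique (intervalIntegral_tendsto_integral integrable
    (tendsto_neg_atTop_atBot.mono_left hl) hl) (tendsto_zero_iff_enorm_tendsto_zero.2 ?_)
  refine tendsto_of_tendsto_of_tendsto_of_le_of_le tendsto_const_nhds ?_ (fun _ => zero_le)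
    fun R => enorm_intervalIntegral_restrictLine_sub_le hr hrd hG (-R) R
  simpa using left.add right

theorem restrictLine_dslope {y : ℝ} (hy : y ≠ 0) (t x : ℝ) :
    restrictLine y (dslope G t) x = cauchyKernel (-y) (x - t) • (restrictLine y G x - G t) := by
  rw [restrictLine, dslope_of_ne _ (fun h => hy (by simpa using congrArg Complex.im h)),
    slope_def_module, cauchyKernel, restrictLine]
  congr 2
  push_cast
  ring

theorem verticalIntegral_dslope_le (r : ℝ) (G : ℂ → X) {t a : ℝ} (ha : |t| < |a|) :
    verticalIntegral r (dslope G t) a ≤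
      ENNReal.ofReal (|a| - |t|)⁻¹ *
        (verticalIntegral r G a + ‖G t‖ₑ * ENNReal.ofReal (2 * r)) := by
  have pointwise (y : ℝ) : ‖dslope G t (a + y * I)‖ₑ ≤
      ENNReal.ofReal (|a| - |t|)⁻¹ * (‖G (a + y * I)‖ₑ + ‖G t‖ₑ) := by
    have le_norm : |a| - |t| ≤ ‖(a : ℂ) + y * I - t‖ := by
      refine (abs_sub_abs_le_abs_sub a t).trans ?_
      simpa using Complex.abs_re_le_norm ((a : ℂ) + y * I - t)
    have ne : (a : ℂ) + y * I ≠ t :=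
      sub_ne_zero.1 (norm_pos_iff.1 ((sub_pos.2 ha).trans_le le_norm))
    rw [dslope_of_ne _ ne, slope_def_module, enorm_smul, ← ofReal_norm (_⁻¹), norm_inv]
    exact mul_le_mul' (ENNReal.ofReal_le_ofReal (inv_anti₀ (sub_pos.2 ha) le_norm)) enorm_sub_le
  refine (lintegral_mono pointwise).trans_eq ?_
  rw [lintegral_const_mul' _ _ ENNReal.ofReal_ne_top, lintegral_add_right _ measurable_const,
    setLIntegral_const, Real.volume_Ioc, sub_neg_eq_add, ← two_mul, verticalIntegral]

theorem tendsto_verticalIntegral_dslope {l : Filter ℝ} {a : ℝ → ℝ} (t : ℝ)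
    (ha : Tendsto (fun R => |a R|) l atTop) (hG : ∀ᶠ R in l, verticalIntegral r G (a R) ≤ 1) :
    Tendsto (fun R => verticalIntegral r (dslope G t) (a R)) l (𝓝 0) := by
  have inv_tendsto : Tendsto (fun R => ENNReal.ofReal (|a R| - |t|)⁻¹) l (𝓝 0) := by
    simpa [sub_eq_add_neg] using ENNReal.tendsto_ofReal
      (tendsto_inv_atTop_zero.comp (tendsto_atTop_add_const_right l (-|t|) ha))
  have bound_tendsto := ENNReal.Tendsto.mul_const inv_tendsto
    (Or.inr (by finiteness : 1 + ‖G t‖ₑ * ENNReal.ofReal (2 * r) ≠ ∞))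
  rw [zero_mul] at bound_tendsto
  refine tendsto_of_tendsto_of_tendsto_of_le_of_le' tendsto_const_nhds bound_tendsto
    (.of_forall fun _ => zero_le) ?_
  filter_upwards [hG, ha.eventually_gt_atTop |t|] with R hGR haR
  exact (verticalIntegral_dslope_le r G haR).trans (mul_le_mul_right (add_le_add_left hGR _) _)

/-- Cauchy's theorem is applied to the difference quotient of `G` at `t`, which is holomorphic
across `t`; its constant part integrates to `2πi`. -/
theorem cauchy_formula_strip [CompleteSpace X] (hr : 0 < r) (hrd : r < d)
    (hG : DifferentiableOn ℂ G (strip d)) (lower : Integrable (restrictLine (-r) G))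
    (upper : Integrable (restrictLine r G)) (vertical : ∫⁻ a, verticalIntegral r G a ≠ ∞) (t : ℝ) :
    (2 * π * I : ℂ) • G t = cauchyTransform r (restrictLine (-r) G) t -
      cauchyTransform (-r) (restrictLine r G) t := by
  have hr' : -r ≠ 0 := neg_ne_zero.2 hr.ne'
  have lower_smul := integrable_cauchyKernel_smul hr.ne' lower t
  have upper_smul := integrable_cauchyKernel_smul hr' upper t
  have const_smul := ((integrable_cauchyKernel_sub hr.ne').comp_sub_right t).smul_const (G t)
  have split (x : ℝ) : restrictLine (-r) (dslope G t) x - restrictLine r (dslope G t) x =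
      cauchyKernel r (x - t) • restrictLine (-r) G x -
        cauchyKernel (-r) (x - t) • restrictLine r G x -
        (cauchyKernel r (x - t) - cauchyKernel (-r) (x - t)) • G t := by
    rw [restrictLine_dslope hr', restrictLine_dslope hr.ne', neg_neg, smul_sub, smul_sub, sub_smul]
    abel
  have hdslope : DifferentiableOn ℂ (dslope G t) (strip d) := (Complex.differentiableOn_dslope
    ((isOpen_strip d).mem_nhds (ofReal_mem_strip (hr.trans hrd) t))).2 hG
  let l : Filter ℝ := atTop ⊓ 𝓟 {R | verticalIntegral r G R ≤ 1 ∧ verticalIntegral r G (-R) ≤ 1}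
  have : l.NeBot := frequently_mem_iff_neBot.1 (frequently_atTop_le_and_neg_le one_ne_zero
    (aemeasurable_enorm_add_mul_I hrd hG.continuousOn).lintegral_prod_right' vertical)
  have bounded : ∀ᶠ R in l, verticalIntegral r G R ≤ 1 ∧ verticalIntegral r G (-R) ≤ 1 :=
    mem_inf_of_right (mem_principal_self _)
  have abs_tendsto : Tendsto (fun R : ℝ => |R|) l atTop :=
    tendsto_abs_atTop_atTop.mono_left inf_le_left
  have integral_eq_zero := integral_restrictLine_sub_eq_zero hr hrd hdslope
    ((lower_smul.sub upper_smul).sub const_smul |>.congr (.of_forall fun x => (split x).symm))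
    (inf_le_left : l ≤ atTop)
    (tendsto_verticalIntegral_dslope t (by simpa using abs_tendsto) (bounded.mono fun _ h => h.2))
    (tendsto_verticalIntegral_dslope t abs_tendsto (bounded.mono fun _ h => h.1))
  simp_rw [split] at integral_eq_zero
  rw [integral_sub (by exact lower_smul.sub upper_smul) const_smul,
    integral_sub lower_smul upper_smul, integral_smul_const,
    integral_sub_right_eq_self fun x => cauchyKernel r x - cauchyKernel (-r) x,
    integral_cauchyKernel_sub hr, sub_eq_zero] at integral_eq_zero
  exact integral_eq_zero.symm

end Strip

section SincRemainder

variable {θ y : ℝ}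

theorem abs_sinh_im_le_norm_sin (z : ℂ) : |Real.sinh z.im| ≤ ‖Complex.sin z‖ := by
  have sin_eq : Complex.sin z = (Real.sin z.re * Real.cosh z.im : ℝ) +
      (Real.cos z.re * Real.sinh z.im : ℝ) * I := by
    conv_lhs => rw [← Complex.re_add_im z, Complex.sin_add_mul_I]
    push_cast
    ring
  rw [← abs_norm, ← sq_le_sq, ← Complex.normSq_eq_norm_sq, sin_eq, Complex.normSq_add_mul_I]
  nlinarith [Real.sin_sq_add_cos_sq z.re, Real.cosh_sq z.im, sq_nonneg (Real.sin z.re)]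

theorem sinh_le_norm_sin_line (hθ : 0 < θ) (y s : ℝ) :
    Real.sinh (π * |y| / θ) ≤ ‖Complex.sin (π * (s - y * I) / θ)‖ := by
  have im_eq : (π * ((s : ℂ) - y * I) / θ).im = -(π * y / θ) := by
    rw [Complex.div_ofReal_im, Complex.im_ofReal_mul]
    simp [neg_div]
  refine le_of_eq_of_le ?_ (abs_sinh_im_le_norm_sin _)
  rw [im_eq, Real.sinh_neg, abs_neg, Real.abs_sinh, abs_div, abs_mul, abs_of_pos hθ,
    abs_of_pos Real.pi_pos]

theorem sinh_pi_mul_abs_div_pos (hθ : 0 < θ) (hy : y ≠ 0) : 0 < Real.sinh (π * |y| / θ) :=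
  Real.sinh_pos_iff.2 (by positivity)

theorem ae_forall_ne_intCast_mul (θ : ℝ) : ∀ᵐ t : ℝ, ∀ k : ℤ, t ≠ k * θ :=
  ae_all_iff.2 fun k => compl_mem_ae_iff.2 (measure_singleton (k * θ))

variable {X : Type*} [NormedAddCommGroup X]

section NormedSpace

variable [NormedSpace ℂ X] {u : ℝ → X}

/-- The function `s ↦ u(s) / sin (π (s - i y) / θ)`: the values `u` of a function on the line
`Im w = -y`, divided by the function `sin (π w / θ)` that vanishes on the grid `θℤ`. -/
noncomputable def divSin (θ y : ℝ) (u : ℝ → X) (s : ℝ) : X :=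
  (Complex.sin (π * (s - y * I) / θ))⁻¹ • u s

theorem norm_divSin_le (hθ : 0 < θ) (hy : y ≠ 0) (u : ℝ → X) (s : ℝ) :
    ‖divSin θ y u s‖ ≤ (Real.sinh (π * |y| / θ))⁻¹ * ‖u s‖ := by
  rw [divSin, norm_smul, norm_inv]
  exact mul_le_mul_of_nonneg_right
    (inv_anti₀ (sinh_pi_mul_abs_div_pos hθ hy) (sinh_le_norm_sin_line hθ y s)) (norm_nonneg _)

theorem stronglyMeasurable_divSin (hu : StronglyMeasurable u) :
    StronglyMeasurable (divSin θ y u) := by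
  unfold divSin
  exact (Measurable.stronglyMeasurable (by fun_prop)).smul hu

theorem integrable_divSin (hθ : 0 < θ) (hy : y ≠ 0) (hu : Integrable u) :
    Integrable (divSin θ y u) := by
  refine (hu.norm.const_mul _).mono' ?_ (.of_forall (norm_divSin_le hθ hy u))
  unfold divSin
  exact (Measurable.aestronglyMeasurable (by fun_prop)).smul hu.1

theorem eLpNorm_divSin_le (hθ : 0 < θ) (hy : y ≠ 0) (u : ℝ → X) :
    eLpNorm (divSin θ y u) 2 volume ≤
      ENNReal.ofReal (Real.sinh (π * |y| / θ))⁻¹ * eLpNorm u 2 volume :=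
  eLpNorm_le_mul_eLpNorm_of_ae_le_mul (.of_forall (norm_divSin_le hθ hy u)) 2

/-- The remainder of the full sinc series of the Cauchy transform of `u`, in closed form. -/
noncomputable def sincRemainder (θ y : ℝ) (u : ℝ → X) (t : ℝ) : X :=
  Real.sin (π * t / θ) • cauchyTransform y (divSin θ y u) t

theorem inv_sub_mul_I_sub (y s x : ℝ) :
    ((s : ℂ) - y * I - x)⁻¹ = cauchyKernel y (s - x) := by
  rw [cauchyKernel]
  congr 1
  push_cast
  ring

theorem sincSum_cauchyTransform (hy : y ≠ 0) (hu : Integrable u) (θ : ℝ) (n : ℕ) (t : ℝ) :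
    sincSum θ n (cauchyTransform y u) t =
      ∫ s, (∑ k ∈ Finset.Icc (-(n : ℤ)) n,
        (Sinc k θ t : ℂ) * cauchyKernel y (s - k * θ)) • u s := by
  simp only [Finset.sum_smul, mul_smul]
  have integrable (k : ℤ) :
      Integrable fun s => (Sinc k θ t : ℂ) • cauchyKernel y (s - k * θ) • u s :=
    (integrable_cauchyKernel_smul hy hu _).smul _
  rw [integral_finsetSum _ fun k _ => integrable k]
  simp only [sincSum, cauchyTransform, integral_smul, Complex.coe_smul]

theorem cauchyTransform_sub_sincRemainder (hθ : 0 < θ) (hy : y ≠ 0) (hu : Integrable u) (t : ℝ) :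
    cauchyTransform y u t - sincRemainder θ y u t =
      ∫ s : ℝ, ((1 - Real.sin (π * t / θ) / Complex.sin (π * (s - y * I) / θ)) *
        cauchyKernel y (s - t)) • u s := by
  rw [sincRemainder, cauchyTransform, cauchyTransform, ← Complex.coe_smul, ← integral_smul,
    ← integral_sub (integrable_cauchyKernel_smul hy hu t)
      (by exact (integrable_cauchyKernel_smul hy (integrable_divSin hθ hy hu) t).smul _)]
  refine integral_congr_ae (.of_forall fun s => ?_)
  simp only [divSin, smul_smul, ← sub_smul]
  congr 1
  ring

theorem tendsto_sincSum_cauchyTransform (hθ : 0 < θ) (hy : y ≠ 0) (hu : Integrable u) {t : ℝ}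
    (ht : ∀ k : ℤ, t ≠ k * θ) :
    Tendsto (fun n : ℕ => sincSum θ n (cauchyTransform y u) t) atTop
      (𝓝 (cauchyTransform y u t - sincRemainder θ y u t)) := by
  obtain ⟨M, norm_sum_le⟩ := exists_forall_norm_sum_Sinc_mul_cauchyKernel_le hθ.ne' hy t
  have hκ := continuous_cauchyKernel hy
  simp_rw [sincSum_cauchyTransform hy hu, cauchyTransform_sub_sincRemainder hθ hy hu]
  refine tendsto_integral_of_dominated_convergence (fun s => M * ‖u s‖)
    (fun n => (Continuous.aestronglyMeasurable (by fun_prop)).smul hu.1) (hu.norm.const_mul M)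
    (fun n => .of_forall fun s => ?_) (.of_forall fun s => Tendsto.smul_const ?_ _)
  · rw [norm_smul]
    exact mul_le_mul_of_nonneg_right (norm_sum_le s _) (norm_nonneg _)
  · simpa only [inv_sub_mul_I_sub] using
      tendsto_sum_Sinc_mul_inv_sub hθ.ne' ht (w := s - y * I) (by simpa using hy)

theorem norm_sincRemainder_le (θ y : ℝ) (u : ℝ → X) (t : ℝ) :
    ‖sincRemainder θ y u t‖ ≤ ‖cauchyTransform y (divSin θ y u) t‖ := by
  rw [sincRemainder, norm_smul]
  exact mul_le_of_le_one_left (norm_nonneg _) (Real.abs_sin_le_one _)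

theorem memLp_sincRemainder (hθ : 0 < θ) (hy : y ≠ 0) (hu : StronglyMeasurable u)
    (hu' : Integrable u) : MemLp (sincRemainder θ y u) 2 volume := by
  have transform := memLp_cauchyTransform hy (stronglyMeasurable_divSin (θ := θ) (y := y) hu)
    (integrable_divSin hθ hy hu')
  have continuous_sin : Continuous fun t => Real.sin (π * t / θ) := by fun_prop
  exact transform.of_le (continuous_sin.aestronglyMeasurable.smul transform.1)
    (.of_forall (norm_sincRemainder_le θ y u))

theorem sincSum_smul_sub (θ : ℝ) (n : ℕ) (c : ℂ) (f g : ℝ → X) :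
    sincSum θ n (c • (f - g)) = c • (sincSum θ n f - sincSum θ n g) := by
  ext t
  simp only [sincSum, Pi.smul_apply, Pi.sub_apply, smul_sub, Finset.sum_sub_distrib,
    Finset.smul_sum, smul_comm c]

end NormedSpace

variable [InnerProductSpace ℂ X] [CompleteSpace X]

theorem eLpNorm_sincRemainder_le {u : ℝ → X} (hθ : 0 < θ) (hy : y ≠ 0) (hu : StronglyMeasurable u)
    (hu' : Integrable u) :
    eLpNorm (sincRemainder θ y u) 2 volume ≤ ENNReal.ofReal (2 * π) *
      (ENNReal.ofReal (Real.sinh (π * |y| / θ))⁻¹ * eLpNorm u 2 volume) := by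
  calc eLpNorm (sincRemainder θ y u) 2 volume
      ≤ eLpNorm (cauchyTransform y (divSin θ y u)) 2 volume :=
        eLpNorm_mono (norm_sincRemainder_le θ y u)
    _ ≤ ENNReal.ofReal (2 * π) * eLpNorm (divSin θ y u) 2 volume :=
        eLpNorm_cauchyTransform_le hy (stronglyMeasurable_divSin hu) (integrable_divSin hθ hy hu')
    _ ≤ _ := mul_le_mul_right (eLpNorm_divSin_le hθ hy u) _

variable {r : ℝ}

theorem eLpNorm_smul_sincRemainder_sub_le {u v : ℝ → X} (hr : 0 < r) (hθ : 0 < θ)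
    (hu : StronglyMeasurable u) (hu' : Integrable u) (hv : StronglyMeasurable v)
    (hv' : Integrable v) :
    eLpNorm ((2 * π * I : ℂ)⁻¹ • (sincRemainder θ r u - sincRemainder θ (-r) v)) 2 volume ≤
      ENNReal.ofReal (Real.sinh (π * r / θ))⁻¹ * (eLpNorm u 2 volume + eLpNorm v 2 volume) := by
  have hr' : -r ≠ 0 := neg_ne_zero.2 hr.ne'
  have bound_u := eLpNorm_sincRemainder_le hθ hr.ne' hu hu'
  have bound_v := eLpNorm_sincRemainder_le hθ hr' hv hv'
  rw [abs_neg] at bound_v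
  rw [abs_of_pos hr] at bound_u bound_v
  have enorm_const : ‖(2 * π * I : ℂ)⁻¹‖ₑ = ENNReal.ofReal (2 * π)⁻¹ := by
    rw [← ofReal_norm]
    simp [abs_of_pos Real.pi_pos]
  rw [eLpNorm_const_smul, enorm_const]
  refine (mul_le_mul_right ((eLpNorm_sub_le (memLp_sincRemainder hθ hr.ne' hu hu').1
    (memLp_sincRemainder hθ hr' hv hv').1 one_le_two).trans
    (add_le_add bound_u bound_v)) _).trans_eq ?_
  rw [← mul_add, ← mul_add, ← mul_assoc, ← ENNReal.ofReal_mul (by positivity),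
    inv_mul_cancel₀ (by positivity), ENNReal.ofReal_one, one_mul]

theorem eLpNorm_sub_sincSum_le_of_eq_cauchyTransform {g u v : ℝ → X} (hr : 0 < r) (hθ : 0 < θ)
    (hu : StronglyMeasurable u) (hu' : Integrable u) (hv : StronglyMeasurable v)
    (hv' : Integrable v)
    (hg : g = (2 * π * I : ℂ)⁻¹ • (cauchyTransform r u - cauchyTransform (-r) v)) (K : ℕ) :
    eLpNorm (g - sincSum θ K g) 2 volume ≤
      ENNReal.ofReal (Real.sinh (π * r / θ))⁻¹ * (eLpNorm u 2 volume + eLpNorm v 2 volume) +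
        ENNReal.ofReal √(2 * θ) * sampleTail θ K g := by
  have hr' : -r ≠ 0 := neg_ne_zero.2 hr.ne'
  set R := (2 * π * I : ℂ)⁻¹ • (sincRemainder θ r u - sincRemainder θ (-r) v)
  have measurable_R : AEStronglyMeasurable R volume :=
    ((memLp_sincRemainder hθ hr.ne' hu hu').1.sub
      (memLp_sincRemainder hθ hr' hv hv').1).const_smul _
  have measurable_g : AEStronglyMeasurable g volume := hg ▸
    ((memLp_cauchyTransform hr.ne' hu hu').1.sub (memLp_cauchyTransform hr' hv hv').1).const_smul _
  have series : ∀ᵐ t, Tendsto (fun n : ℕ => sincSum θ n g t) atTop (𝓝 ((g - R) t)) := by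
    filter_upwards [ae_forall_ne_intCast_mul θ] with t ht
    have limit := ((tendsto_sincSum_cauchyTransform hθ hr.ne' hu' ht).sub
      (tendsto_sincSum_cauchyTransform hθ hr' hv' ht)).const_smul (2 * π * I : ℂ)⁻¹
    rw [sub_sub_sub_comm, smul_sub] at limit
    simp only [Pi.sub_apply, R, hg, sincSum_smul_sub]
    exact limit
  calc eLpNorm (g - sincSum θ K g) 2 volume
      = eLpNorm (R + (g - R - sincSum θ K g)) 2 volume := by
        rw [sub_right_comm, add_sub_cancel]
    _ ≤ eLpNorm R 2 volume + eLpNorm (g - R - sincSum θ K g) 2 volume :=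
        eLpNorm_add_le measurable_R ((measurable_g.sub measurable_R).sub
          (continuous_sincSum θ K g).aestronglyMeasurable) one_le_two
    _ ≤ _ := add_le_add (eLpNorm_smul_sincRemainder_sub_le hr hθ hu hu' hv hv')
        (eLpNorm_sub_sincSum_le_sampleTail hθ K series)

theorem eLpNorm_sub_sincSum_le_of_integrable {d : ℝ} {G : ℂ → X} (hr : 0 < r) (hrd : r < d)
    (hθ : 0 < θ) (hG : DifferentiableOn ℂ G (strip d)) (lower : Integrable (restrictLine (-r) G))
    (upper : Integrable (restrictLine r G)) (vertical : ∫⁻ a, verticalIntegral r G a ≠ ∞) (K : ℕ) :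
    eLpNorm (restrictLine 0 G - sincSum θ K (restrictLine 0 G)) 2 volume ≤
      ENNReal.ofReal (Real.sinh (π * r / θ))⁻¹ *
        (eLpNorm (restrictLine (-r) G) 2 volume + eLpNorm (restrictLine r G) 2 volume) +
      ENNReal.ofReal √(2 * θ) * sampleTail θ K (restrictLine 0 G) := by
  have abs_r : |r| < d := by rwa [abs_of_pos hr]
  refine eLpNorm_sub_sincSum_le_of_eq_cauchyTransform hr hθ
    (continuous_restrictLine hG.continuousOn (by rwa [abs_neg])).stronglyMeasurable lower
    (continuous_restrictLine hG.continuousOn abs_r).stronglyMeasurable upper ?_ K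
  ext t
  rw [restrictLine_zero, Pi.smul_apply, eq_inv_smul_iff₀ (by simp [Real.pi_ne_zero])]
  exact cauchy_formula_strip hr hrd hG lower upper vertical t

end SincRemainder

section Regularization

variable {X : Type*} [NormedAddCommGroup X]

theorem norm_exp_neg_mul_add_mul_I_sq (ε s y : ℝ) :
    ‖Complex.exp (-ε * ((s : ℂ) + y * I) ^ 2)‖ = Real.exp (ε * y ^ 2) * Real.exp (-ε * s ^ 2) := by
  rw [Complex.norm_exp, ← Real.exp_add]
  congr 1
  have re_eq : -(ε : ℂ) * ((s : ℂ) + y * I) ^ 2 =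
      (ε * y ^ 2 + -ε * s ^ 2 : ℝ) + (-(2 * ε * s * y) : ℝ) * I := by
    push_cast
    linear_combination (-(ε : ℂ) * y ^ 2) * Complex.I_sq
  rw [re_eq, Complex.add_re, Complex.ofReal_re, Complex.re_ofReal_mul, Complex.I_re, mul_zero,
    add_zero]

theorem memLp_two_exp_neg_mul_sq {ε : ℝ} (hε : 0 < ε) :
    MemLp (fun s : ℝ => Real.exp (-ε * s ^ 2)) 2 volume := by
  rw [memLp_two_iff_integrable_sq (Continuous.aestronglyMeasurable (by fun_prop))]
  simp only [← Real.exp_nat_mul]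
  convert integrable_exp_neg_mul_sq (b := 2 * ε) (by positivity) using 3
  push_cast
  ring

section NormedSpace

variable [NormedSpace ℂ X] {d ε : ℝ}

/-- Multiplication by the Gaussian `exp (-ε w²)`, which makes a function with square integrable
restrictions to horizontal lines integrable along these lines. -/
noncomputable def gaussReg (ε : ℝ) (G : ℂ → X) (w : ℂ) : X := Complex.exp (-ε * w ^ 2) • G w

theorem norm_restrictLine_gaussReg (ε y : ℝ) (G : ℂ → X) (s : ℝ) :
    ‖restrictLine y (gaussReg ε G) s‖ =
      Real.exp (ε * y ^ 2) * ‖Real.exp (-ε * s ^ 2) • restrictLine y G s‖ := by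
  rw [restrictLine, gaussReg, norm_smul, norm_exp_neg_mul_add_mul_I_sq, norm_smul,
    Real.norm_of_nonneg (Real.exp_pos _).le, restrictLine, mul_assoc]

theorem norm_restrictLine_gaussReg_le (hε : 0 ≤ ε) (y : ℝ) (G : ℂ → X) (s : ℝ) :
    ‖restrictLine y (gaussReg ε G) s‖ ≤ Real.exp (ε * y ^ 2) * ‖restrictLine y G s‖ := by
  rw [norm_restrictLine_gaussReg, norm_smul, Real.norm_of_nonneg (Real.exp_pos _).le]
  have exp_le_one : Real.exp (-ε * s ^ 2) ≤ 1 := Real.exp_le_one_iff.2 (by nlinarith [sq_nonneg s])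
  exact mul_le_mul_of_nonneg_left (mul_le_of_le_one_left (norm_nonneg _) exp_le_one)
    (Real.exp_pos _).le

theorem eLpNorm_two_restrictLine_gaussReg_le (hε : 0 ≤ ε) (y : ℝ) (G : ℂ → X) :
    eLpNorm (restrictLine y (gaussReg ε G)) 2 volume ≤
      ENNReal.ofReal (Real.exp (ε * y ^ 2)) * eLpNorm (restrictLine y G) 2 volume :=
  eLpNorm_le_mul_eLpNorm_of_ae_le_mul (.of_forall (norm_restrictLine_gaussReg_le hε y G)) 2

theorem eLpNorm_one_restrictLine_gaussReg_le (ε : ℝ) {y : ℝ} {G : ℂ → X}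
    (hG : AEStronglyMeasurable (restrictLine y G) volume) :
    eLpNorm (restrictLine y (gaussReg ε G)) 1 volume ≤
      ENNReal.ofReal (Real.exp (ε * y ^ 2)) *
        (eLpNorm (fun s : ℝ => Real.exp (-ε * s ^ 2)) 2 volume *
          eLpNorm (restrictLine y G) 2 volume) := by
  refine (eLpNorm_le_mul_eLpNorm_of_ae_le_mul
    (.of_forall fun s => (norm_restrictLine_gaussReg ε y G s).le) 1).trans (mul_le_mul_right ?_ _)
  exact eLpNorm_smul_le_mul_eLpNorm hG (Continuous.aestronglyMeasurable (by fun_prop))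

theorem differentiableOn_gaussReg (ε : ℝ) {G : ℂ → X} (hG : DifferentiableOn ℂ G (strip d)) :
    DifferentiableOn ℂ (gaussReg ε G) (strip d) := by
  unfold gaussReg
  exact (Differentiable.differentiableOn (by fun_prop)).smul hG

theorem sampleTail_gaussReg_le (hε : 0 ≤ ε) (θ : ℝ) (K : ℕ) (G : ℂ → X) :
    sampleTail θ K (restrictLine 0 (gaussReg ε G)) ≤ sampleTail θ K (restrictLine 0 G) := by
  have norm_le (s : ℝ) : ‖restrictLine 0 (gaussReg ε G) s‖ₑ ≤ ‖restrictLine 0 G s‖ₑ := by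
    rw [enorm_le_iff_norm_le]
    simpa using norm_restrictLine_gaussReg_le hε 0 G s
  exact ENNReal.tsum_le_tsum fun n => add_le_add (norm_le _) (norm_le _)

theorem tendsto_restrictLine_gaussReg (G : ℂ → X) (y s : ℝ) :
    Tendsto (fun n : ℕ => restrictLine y (gaussReg (1 / (n + 1)) G) s) atTop
      (𝓝 (restrictLine y G s)) := by
  have continuous_exp : Continuous fun ε : ℝ => Complex.exp (-ε * ((s : ℂ) + y * I) ^ 2) := by
    fun_prop
  have tendsto_exp := (continuous_exp.tendsto 0).comp tendsto_one_div_add_atTop_nhds_zero_nat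
  simpa [gaussReg, restrictLine, Function.comp_def] using tendsto_exp.smul_const (G (s + y * I))

end NormedSpace

variable [InnerProductSpace ℂ X] [CompleteSpace X] {d r θ : ℝ} {G : ℂ → X} {N : ℝ≥0∞}

theorem eLpNorm_gaussReg_sub_sincSum_le {ε : ℝ} (hε : 0 < ε) (hr : 0 < r) (hrd : r < d) (hθ : 0 < θ)
    (hG : DifferentiableOn ℂ G (strip d)) (hN : N ≠ ∞)
    (bound : ∀ y, y ≠ 0 → |y| < d → eLpNorm (restrictLine y G) 2 volume ≤ N) (K : ℕ) :
    eLpNorm (restrictLine 0 (gaussReg ε G) - sincSum θ K (restrictLine 0 (gaussReg ε G))) 2 volume ≤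
      ENNReal.ofReal (Real.sinh (π * r / θ))⁻¹ *
          (ENNReal.ofReal (Real.exp (ε * r ^ 2)) * (2 * N)) +
        ENNReal.ofReal √(2 * θ) * sampleTail θ K (restrictLine 0 G) := by
  have hGε := differentiableOn_gaussReg ε hG
  set B : ℝ≥0∞ := ENNReal.ofReal (Real.exp (ε * r ^ 2)) *
    (eLpNorm (fun s : ℝ => Real.exp (-ε * s ^ 2)) 2 volume * N)
  have hB : B ≠ ∞ := ENNReal.mul_ne_top ENNReal.ofReal_ne_top
    (ENNReal.mul_ne_top (memLp_two_exp_neg_mul_sq hε).2.ne hN)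
  have exp_le {y : ℝ} (hy : |y| ≤ r) :
      ENNReal.ofReal (Real.exp (ε * y ^ 2)) ≤ ENNReal.ofReal (Real.exp (ε * r ^ 2)) :=
    ENNReal.ofReal_le_ofReal (Real.exp_le_exp.2
      (mul_le_mul_of_nonneg_left (sq_le_sq' (abs_le.1 hy).1 (abs_le.1 hy).2) hε.le))
  have bound_one {y : ℝ} (hy₀ : y ≠ 0) (hy : |y| ≤ r) :
      eLpNorm (restrictLine y (gaussReg ε G)) 1 volume ≤ B :=
    (eLpNorm_one_restrictLine_gaussReg_le ε
      (continuous_restrictLine hG.continuousOn (hy.trans_lt hrd)).aestronglyMeasurable).trans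
      (mul_le_mul' (exp_le hy) (mul_le_mul_right (bound y hy₀ (hy.trans_lt hrd)) _))
  have bound_two {y : ℝ} (hy₀ : y ≠ 0) (hy : |y| ≤ r) :
      eLpNorm (restrictLine y (gaussReg ε G)) 2 volume ≤
        ENNReal.ofReal (Real.exp (ε * r ^ 2)) * N :=
    (eLpNorm_two_restrictLine_gaussReg_le hε.le y G).trans
      (mul_le_mul' (exp_le hy) (bound y hy₀ (hy.trans_lt hrd)))
  have integrable {y : ℝ} (hy₀ : y ≠ 0) (hy : |y| ≤ r) :
      Integrable (restrictLine y (gaussReg ε G)) :=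
    memLp_one_iff_integrable.1
      ⟨(continuous_restrictLine hGε.continuousOn (hy.trans_lt hrd)).aestronglyMeasurable,
        (bound_one hy₀ hy).trans_lt hB.lt_top⟩
  have abs_r : |r| ≤ r := (abs_of_pos hr).le
  have abs_neg_r : |-r| ≤ r := (abs_neg r).trans_le abs_r
  have neg_r_ne : -r ≠ 0 := neg_ne_zero.2 hr.ne'
  refine (eLpNorm_sub_sincSum_le_of_integrable hr hrd hθ hGε (integrable neg_r_ne abs_neg_r)
    (integrable hr.ne' abs_r) (lintegral_verticalIntegral_ne_top hrd hGε.continuousOn hB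
      fun y hy₀ hy => (eLpNorm_one_eq_lintegral_enorm).ge.trans (bound_one hy₀ hy)) K).trans
    (add_le_add (mul_le_mul_right ?_ _) (mul_le_mul_right (sampleTail_gaussReg_le hε.le θ K G) _))
  rw [two_mul, mul_add]
  exact add_le_add (bound_two neg_r_ne abs_neg_r) (bound_two hr.ne' abs_r)

theorem eLpNorm_sub_sincSum_le_of_lt (hr : 0 < r) (hrd : r < d) (hθ : 0 < θ)
    (hG : DifferentiableOn ℂ G (strip d)) (hN : N ≠ ∞)
    (bound : ∀ y, y ≠ 0 → |y| < d → eLpNorm (restrictLine y G) 2 volume ≤ N) (K : ℕ) :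
    eLpNorm (restrictLine 0 G - sincSum θ K (restrictLine 0 G)) 2 volume ≤
      ENNReal.ofReal (Real.sinh (π * r / θ))⁻¹ * (2 * N) +
        ENNReal.ofReal √(2 * θ) * sampleTail θ K (restrictLine 0 G) := by
  set g : ℕ → ℝ → X := fun n => restrictLine 0 (gaussReg (1 / (n + 1)) G)
  have continuous_g (n : ℕ) : Continuous (g n) :=
    continuous_restrictLine (differentiableOn_gaussReg _ hG).continuousOn
      (by simpa using hr.trans hrd)
  have pointwise (t : ℝ) : Tendsto (fun n => (g n - sincSum θ K (g n)) t) atTop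
      (𝓝 ((restrictLine 0 G - sincSum θ K (restrictLine 0 G)) t)) :=
    (tendsto_restrictLine_gaussReg G 0 t).sub
      (tendsto_finsetSum _ fun k _ => (tendsto_restrictLine_gaussReg G 0 _).const_smul _)
  have fatou := Lp.eLpNorm_lim_le_liminf_eLpNorm (p := 2) (μ := volume)
    (fun n => ((continuous_g n).sub (continuous_sincSum θ K _)).aestronglyMeasurable) _
    (.of_forall pointwise)
  refine fatou.trans ((liminf_le_liminf (.of_forall fun n => eLpNorm_gaussReg_sub_sincSum_le
    Nat.one_div_pos_of_nat hr hrd hθ hG hN bound K)).trans_eq (Tendsto.liminf_eq ?_))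
  have continuous_exp : Continuous fun ε : ℝ => ENNReal.ofReal (Real.exp (ε * r ^ 2)) :=
    ENNReal.continuous_ofReal.comp (by fun_prop)
  have tendsto_exp : Tendsto (fun n : ℕ => ENNReal.ofReal (Real.exp (1 / (n + 1) * r ^ 2))) atTop
      (𝓝 1) := by
    simpa [Function.comp_def] using
      (continuous_exp.tendsto 0).comp tendsto_one_div_add_atTop_nhds_zero_nat
  have tendsto_mul := ENNReal.Tendsto.mul_const (b := 2 * N) tendsto_exp
    (.inr (ENNReal.mul_ne_top ENNReal.ofNat_ne_top hN))
  rw [one_mul] at tendsto_mul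
  exact (ENNReal.Tendsto.const_mul tendsto_mul (.inr ENNReal.ofReal_ne_top)).add_const _

theorem eLpNorm_sub_sincSum_le (hd : 0 < d) (hθ : 0 < θ)
    (hG : DifferentiableOn ℂ G (strip d)) (hN : N ≠ ∞)
    (bound : ∀ y, y ≠ 0 → |y| < d → eLpNorm (restrictLine y G) 2 volume ≤ N) (K : ℕ) :
    eLpNorm (restrictLine 0 G - sincSum θ K (restrictLine 0 G)) 2 volume ≤
      ENNReal.ofReal (Real.sinh (π * d / θ))⁻¹ * (2 * N) +
        ENNReal.ofReal √(2 * θ) * sampleTail θ K (restrictLine 0 G) := by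
  have sinh_ne_zero : Real.sinh (π * d / θ) ≠ 0 := (Real.sinh_pos_iff.2 (by positivity)).ne'
  have continuous_sinh : Continuous fun r : ℝ => Real.sinh (π * r / θ) := by fun_prop
  have tendsto_inv : Tendsto (fun r => ENNReal.ofReal (Real.sinh (π * r / θ))⁻¹) (𝓝[<] d)
      (𝓝 (ENNReal.ofReal (Real.sinh (π * d / θ))⁻¹)) :=
    (ENNReal.tendsto_ofReal ((continuous_sinh.tendsto d).inv₀ sinh_ne_zero)).mono_left
      nhdsWithin_le_nhds
  refine ge_of_tendsto ((ENNReal.Tendsto.mul_const tendsto_inv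
    (.inr (ENNReal.mul_ne_top ENNReal.ofNat_ne_top hN))).add_const _) ?_
  filter_upwards [Ioo_mem_nhdsLT hd] with r hr
  exact eLpNorm_sub_sincSum_le_of_lt hr.1 hr.2 hθ hG hN bound K

end Regularization

section Pullback

variable {d : ℝ}

theorem re_cosh (w : ℂ) : (Complex.cosh w).re = Real.cosh w.re * Real.cos w.im := by
  conv_lhs => rw [← Complex.re_add_im w, Complex.cosh_add, Complex.cosh_mul_I, Complex.sinh_mul_I,
    ← Complex.ofReal_cosh, ← Complex.ofReal_sinh, ← Complex.ofReal_cos, ← Complex.ofReal_sin]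
  simp [-Complex.ofReal_cos, -Complex.ofReal_sin, -Complex.ofReal_cosh, -Complex.ofReal_sinh]

theorem cosh_re_pos_of_mem_strip (hd : d ≤ π / 2) {w : ℂ} (hw : w ∈ strip d) :
    0 < (Complex.cosh w).re := by
  rw [re_cosh]
  exact mul_pos (Real.cosh_pos _)
    (Real.cos_pos_of_mem_Ioo (abs_lt.1 (lt_of_lt_of_le (show |w.im| < d from hw) hd)))

theorem sinh_mem_domain (hd : d ≤ π / 2) {w : ℂ} (hw : w ∈ strip d) :
    Complex.sinh w ∈ domain d := by
  have sqrt_eq_cosh : (1 + Complex.sinh w ^ 2) ^ (1 / 2 : ℂ) = Complex.cosh w := by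
    rw [add_comm, ← Complex.cosh_sq, one_div,
      Complex.sq_cpow_two_inv (cosh_re_pos_of_mem_strip hd hw)]
  obtain ⟨neg_lt_im, im_lt⟩ := abs_lt.1 (show |w.im| < d from hw)
  change |Complex.arg _| < d
  rw [sqrt_eq_cosh, Complex.sinh_add_cosh, ← Complex.log_im,
    Complex.log_exp (by linarith [Real.pi_pos]) (by linarith [Real.pi_pos])]
  exact hw

theorem ofReal_mem_domain (hd₀ : 0 < d) (hd : d ≤ π / 2) (x : ℝ) : (x : ℂ) ∈ domain d := by
  simpa [← Complex.ofReal_sinh] using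
    sinh_mem_domain hd (ofReal_mem_strip hd₀ (Real.arsinh x))

theorem deriv_curve (y s : ℝ) : deriv (curve y) s = Complex.cosh (s + y * I) := by
  have hasDerivAt_line : HasDerivAt (fun t : ℝ => (t : ℂ) + y * I) 1 s :=
    (Complex.ofRealCLM.hasDerivAt (x := s)).add_const _
  exact ((Complex.hasDerivAt_sinh _).comp_of_eq s hasDerivAt_line rfl).deriv.trans (mul_one _)

variable {X : Type*} [NormedAddCommGroup X] [NormedSpace ℂ X] {F : ℂ → X}

/-- The pullback `w ↦ cosh(w)^{1/2} F(sinh w)` of `F` under `sinh`, weighted so that it preserves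
the `L²` norm with respect to arc length. -/
noncomputable def pullback (F : ℂ → X) (w : ℂ) : X :=
  Complex.cosh w ^ (2⁻¹ : ℂ) • F (Complex.sinh w)

theorem differentiableOn_pullback (hd : d ≤ π / 2) (hF : AnalyticOnNhd ℂ F (domain d)) :
    DifferentiableOn ℂ (pullback F) (strip d) :=
  (Complex.differentiable_cosh.differentiableOn.cpow_const fun _ hw =>
    .inl (cosh_re_pos_of_mem_strip hd hw)).smul
    (hF.differentiableOn.comp Complex.differentiable_sinh.differentiableOn fun _ hw =>
      sinh_mem_domain hd hw)

theorem norm_pullback_sq (F : ℂ → X) (w : ℂ) :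
    ‖pullback F w‖ ^ 2 = ‖F (Complex.sinh w)‖ ^ 2 * ‖Complex.cosh w‖ := by
  rw [pullback, norm_smul, mul_pow, ← norm_pow, Complex.cpow_ofNat_inv_pow, mul_comm]

theorem lintegral_restrictLine_pullback (F : ℂ → X) (y : ℝ) :
    ∫⁻ s, ‖restrictLine y (pullback F) s‖ₑ ^ 2 =
      arcLengthIntegral (curve y) fun z => ‖F z‖ₑ ^ (2 : ℝ) := by
  refine lintegral_congr fun s => ?_
  simp only [deriv_curve, ENNReal.rpow_two, curve, restrictLine]
  rw [← ofReal_norm, ← ofReal_norm, ← ofReal_norm, ← ENNReal.ofReal_pow (norm_nonneg _),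
    ← ENNReal.ofReal_pow (norm_nonneg _), ← ENNReal.ofReal_mul (by positivity), norm_pullback_sq]

theorem eLpNorm_restrictLine_pullback_le_hardyNorm (F : ℂ → X) {y : ℝ} (hy₀ : y ≠ 0)
    (hy : |y| < d) : eLpNorm (restrictLine y (pullback F)) 2 volume ≤ hardyNorm 2 d F := by
  rw [eLpNorm_two_le_iff, lintegral_restrictLine_pullback, hardyNorm, ← ENNReal.rpow_two,
    ← ENNReal.rpow_mul, one_div_mul_cancel two_ne_zero, ENNReal.rpow_one]
  refine le_trans ?_ (le_iSup₂ (f := fun r (_ : r ∈ Set.Ioo 0 d) => boundaryIntegral 2 r F)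
    |y| ⟨abs_pos.2 hy₀, hy⟩)
  rw [boundaryIntegral]
  rcases abs_choice y with abs_eq | abs_eq <;> rw [abs_eq]
  · exact le_self_add
  · rw [neg_neg]
    exact le_add_self

theorem restrictLine_zero_pullback (F : ℂ → X) (t : ℝ) :
    restrictLine 0 (pullback F) t = √(Real.cosh t) • F (Real.sinh t : ℝ) := by
  rw [restrictLine_zero, pullback, ← Complex.ofReal_cosh, ← Complex.ofReal_sinh,
    ← Complex.coe_smul, Real.sqrt_eq_rpow, Complex.ofReal_cpow (Real.cosh_pos _).le]
  norm_num

theorem deriv_phi (x : ℝ) : deriv phi x = (√(1 + x ^ 2))⁻¹ :=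
  (Real.hasDerivAt_arsinh x).deriv

theorem sqrt_deriv_phi_sinh (t : ℝ) : √(deriv phi (Real.sinh t)) = (√(Real.cosh t))⁻¹ := by
  rw [deriv_phi, ← Real.cosh_sq', Real.sqrt_sq (Real.cosh_pos t).le, Real.sqrt_inv]

theorem sub_interpolant_sinh (θ : ℝ) (K : ℕ) (F : ℂ → X) (t : ℝ) :
    F (Real.sinh t : ℝ) - interpolant θ K F (Real.sinh t) = (√(Real.cosh t))⁻¹ •
      (restrictLine 0 (pullback F) - sincSum θ K (restrictLine 0 (pullback F))) t := by
  have sqrt_cosh_ne_zero : √(Real.cosh t) ≠ 0 := (Real.sqrt_pos.2 (Real.cosh_pos t)).ne'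
  rw [Pi.sub_apply, smul_sub, restrictLine_zero_pullback, inv_smul_smul₀ sqrt_cosh_ne_zero,
    interpolant, sqrt_deriv_phi_sinh, sincSum]
  congr 2
  refine Finset.sum_congr rfl fun k _ => ?_
  rw [restrictLine_zero_pullback, sincPoint, sqrt_deriv_phi_sinh, phi, Real.arsinh_sinh, smul_smul,
    div_inv_eq_mul]

theorem eLpNorm_sub_interpolant (θ : ℝ) (K : ℕ) (F : ℂ → X) :
    eLpNorm (fun x : ℝ => F x - interpolant θ K F x) 2 volume =
      eLpNorm (restrictLine 0 (pullback F) - sincSum θ K (restrictLine 0 (pullback F)))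
        2 volume := by
  refine (ENNReal.pow_right_strictMono two_ne_zero).injective ?_
  simp only [eLpNorm_two_sq]
  have change_of_variables := lintegral_image_eq_lintegral_abs_deriv_mul MeasurableSet.univ
    (fun x _ => (Real.hasDerivAt_sinh x).hasDerivWithinAt) Real.sinh_injective.injOn
    (fun x : ℝ => ‖F x - interpolant θ K F x‖ₑ ^ 2)
  rw [Set.image_univ, Real.sinh_surjective.range_eq, setLIntegral_univ,
    setLIntegral_univ] at change_of_variables
  rw [change_of_variables]
  refine lintegral_congr fun t => ?_
  have cosh_pos := Real.cosh_pos t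
  rw [sub_interpolant_sinh, enorm_smul, mul_pow, ← mul_assoc, Real.enorm_eq_ofReal (by positivity),
    ← ENNReal.ofReal_pow (by positivity), abs_of_pos cosh_pos, ← ENNReal.ofReal_mul cosh_pos.le,
    inv_pow, Real.sq_sqrt cosh_pos.le, mul_inv_cancel₀ cosh_pos.ne', ENNReal.ofReal_one, one_mul]

theorem continuous_interpolant (θ : ℝ) (K : ℕ) (F : ℂ → X) : Continuous (interpolant θ K F) := by
  have continuous_sqrt_deriv : Continuous fun x => √(deriv phi x) := by
    simp only [deriv_phi]
    exact Real.continuous_sqrt.comp (Continuous.inv₀ (by fun_prop) fun x => by positivity)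
  exact continuous_sqrt_deriv.smul (continuous_finsetSum _ fun k _ =>
    (((continuous_Sinc k θ).comp Real.continuous_arsinh).div_const _).smul continuous_const)

end Pullback

section Decay

theorem sampleTail_le_of_norm_le_exp {E : Type*} [NormedAddCommGroup E] {A a θ : ℝ} {g : ℝ → E}
    (ha : 0 < a) (hθ : 0 < θ) (decay : ∀ t, ‖g t‖ ≤ A * Real.exp (-(a * |t|))) (K : ℕ) :
    sampleTail θ K g ≤ ENNReal.ofReal (2 * A * Real.exp (-(a * (K * θ))) / (a * θ)) := by
  have hA : 0 ≤ A := (norm_nonneg (g 0)).trans (by simpa using decay 0)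
  set q := Real.exp (-(a * θ))
  have q_lt_one : q < 1 := Real.exp_lt_one_iff.2 (neg_lt_zero.2 (mul_pos ha hθ))
  have term_le (n : ℕ) : ‖g ((K + n + 1) * θ)‖ₑ + ‖g (-(K + n + 1) * θ)‖ₑ ≤
      ENNReal.ofReal (2 * A * Real.exp (-(a * (K * θ))) * q * q ^ n) := by
    have abs_eq : |((K : ℝ) + n + 1) * θ| = (K + n + 1) * θ := abs_of_nonneg (by positivity)
    have exp_eq : Real.exp (-(a * ((K + n + 1) * θ))) = Real.exp (-(a * (K * θ))) * q * q ^ n := by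
      rw [← Real.exp_nat_mul, ← Real.exp_add, ← Real.exp_add]
      ring_nf
    have right := decay ((K + n + 1) * θ)
    have left := decay (-(K + n + 1) * θ)
    rw [neg_mul, abs_neg] at left
    rw [abs_eq, exp_eq] at right left
    rw [← ofReal_norm, ← ofReal_norm, ← ENNReal.ofReal_add (norm_nonneg _) (norm_nonneg _), neg_mul]
    exact ENNReal.ofReal_le_ofReal (by linarith)
  have geometric := (hasSum_geometric_of_lt_one (Real.exp_pos _).le q_lt_one).mul_left
    (2 * A * Real.exp (-(a * (K * θ))) * q)
  have ratio_le : q * (1 - q)⁻¹ ≤ (a * θ)⁻¹ := by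
    have q_mul_exp : q * Real.exp (a * θ) = 1 := by rw [← Real.exp_add]; simp
    rw [← div_eq_mul_inv, ← one_div, div_le_div_iff₀ (sub_pos.2 q_lt_one) (by positivity)]
    nlinarith [Real.add_one_le_exp (a * θ), Real.exp_pos (-(a * θ))]
  calc sampleTail θ K g
      ≤ ∑' n : ℕ, ENNReal.ofReal (2 * A * Real.exp (-(a * (K * θ))) * q * q ^ n) :=
        ENNReal.tsum_le_tsum term_le
    _ = ENNReal.ofReal (2 * A * Real.exp (-(a * (K * θ))) * q * (1 - q)⁻¹) := by
        rw [← ENNReal.ofReal_tsum_of_nonneg (fun n => by positivity) geometric.summable,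
          geometric.tsum_eq]
    _ ≤ _ := by
        rw [mul_assoc, div_eq_mul_inv]
        gcongr

theorem inv_sqrt_cosh_le (t : ℝ) : (√(Real.cosh t))⁻¹ ≤ √2 * Real.exp (-(2⁻¹ * |t|)) := by
  have exp_abs_le : Real.exp |t| ≤ 2 * Real.cosh t := by
    rw [Real.cosh_eq, mul_div_cancel₀ _ two_ne_zero]
    exact Real.exp_abs_le t
  have := Real.cosh_pos t
  rw [Real.exp_neg, inv_mul_eq_div, Real.exp_half, ← div_eq_mul_inv, inv_eq_one_div,
    div_le_div_iff₀ (by positivity) (by positivity), one_mul, ← Real.sqrt_mul zero_le_two]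
  exact Real.sqrt_le_sqrt exp_abs_le

variable {X : Type*} [NormedAddCommGroup X] [NormedSpace ℂ X] {F : ℂ → X} {C : ℝ}

theorem norm_restrictLine_zero_pullback_le (hF : ∀ x : ℝ, ‖F x‖ ≤ C / √(1 + x ^ 2)) (t : ℝ) :
    ‖restrictLine 0 (pullback F) t‖ ≤ √2 * C * Real.exp (-(2⁻¹ * |t|)) := by
  have hC : 0 ≤ C := (norm_nonneg (F (0 : ℝ))).trans (by simpa using hF 0)
  have norm_le := hF (Real.sinh t)
  rw [← Real.cosh_sq', Real.sqrt_sq (Real.cosh_pos t).le] at norm_le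
  calc ‖restrictLine 0 (pullback F) t‖
      = √(Real.cosh t) * ‖F (Real.sinh t : ℝ)‖ := by
        rw [restrictLine_zero_pullback, norm_smul, Real.norm_of_nonneg (Real.sqrt_nonneg _)]
    _ ≤ √(Real.cosh t) * (C / Real.cosh t) := by gcongr
    _ = C * (√(Real.cosh t))⁻¹ := by rw [← Real.sqrt_div_self]; ring
    _ ≤ C * (√2 * Real.exp (-(2⁻¹ * |t|))) := by gcongr; exact inv_sqrt_cosh_le t
    _ = √2 * C * Real.exp (-(2⁻¹ * |t|)) := by ring

theorem ofReal_sqrt_mul_sampleTail_pullback_le {θ : ℝ} (hθ : 0 < θ)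
    (hF : ∀ x : ℝ, ‖F x‖ ≤ C / √(1 + x ^ 2)) (K : ℕ) :
    ENNReal.ofReal √(2 * θ) * sampleTail θ K (restrictLine 0 (pullback F)) ≤
      ENNReal.ofReal (8 * C * Real.exp (-(K * θ / 2)) / √θ) := by
  refine (mul_le_mul_right (sampleTail_le_of_norm_le_exp (a := 2⁻¹) (by positivity) hθ
    (norm_restrictLine_zero_pullback_le hF) K) _).trans_eq ?_
  rw [← ENNReal.ofReal_mul (Real.sqrt_nonneg _), inv_mul_eq_div]
  congr 1
  have sq_sqrt_two : √(2 : ℝ) ^ 2 = 2 := Real.sq_sqrt zero_le_two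
  have sq_sqrt_θ : √θ ^ 2 = θ := Real.sq_sqrt hθ.le
  calc √(2 * θ) * (2 * (√2 * C) * Real.exp (-(K * θ / 2)) / (2⁻¹ * θ))
      = √2 * √θ * (2 * (√2 * C) * Real.exp (-(K * θ / 2)) / (2⁻¹ * √θ ^ 2)) := by
        rw [sq_sqrt_θ, Real.sqrt_mul zero_le_two]
    _ = 4 * √2 ^ 2 * C * Real.exp (-(K * θ / 2)) / √θ := by
        have : √θ ≠ 0 := (Real.sqrt_pos.2 hθ).ne'
        field_simp
        ring
    _ = 8 * C * Real.exp (-(K * θ / 2)) / √θ := by rw [sq_sqrt_two]; ring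

end Decay

theorem eLpNorm_sub_interpolant_le {X : Type*} [NormedAddCommGroup X] [InnerProductSpace ℂ X]
    [CompleteSpace X] {d θ C : ℝ} {F : ℂ → X} (hd₀ : 0 < d) (hd : d ≤ π / 2) (hθ : 0 < θ)
    (hF : MemHardy 2 d F) (decay : ∀ x : ℝ, ‖F x‖ ≤ C / √(1 + x ^ 2)) (K : ℕ) :
    eLpNorm (fun x : ℝ => F x - interpolant θ K F x) 2 volume ≤
      ENNReal.ofReal ((Real.sinh (π * d / θ))⁻¹ * (2 * (hardyNorm 2 d F).toReal) +
        8 * C * Real.exp (-(K * θ / 2)) / √θ) := by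
  have hC : 0 ≤ C := (norm_nonneg (F (0 : ℝ))).trans (by simpa using decay 0)
  have inv_sinh_nonneg : 0 ≤ (Real.sinh (π * d / θ))⁻¹ :=
    inv_nonneg.2 (Real.sinh_nonneg_iff.2 (by positivity))
  rw [eLpNorm_sub_interpolant, ENNReal.ofReal_add (by positivity) (by positivity),
    ENNReal.ofReal_mul inv_sinh_nonneg, ENNReal.ofReal_mul zero_le_two,
    ENNReal.ofReal_toReal hF.2.ne, ENNReal.ofReal_ofNat]
  exact (eLpNorm_sub_sincSum_le hd₀ hθ (differentiableOn_pullback hd hF.1) hF.2.ne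
    (fun _ => eLpNorm_restrictLine_pullback_le_hardyNorm F) K).trans
    (add_le_add_right (ofReal_sqrt_mul_sampleTail_pullback_le hθ decay K) _)

section Constants

variable {d K : ℝ}

/-- The constant `C(d)` of the error bound. The first summand comes from the remainder of the
infinite sinc series, the second from its truncation. -/
noncomputable def errorConst (d : ℝ) : ℝ :=
  4 / (1 - Real.exp (-(2 * √(π * d / 2)))) + 8 / √√(2 * π * d)

theorem one_sub_exp_neg_two_mul_pos {s : ℝ} (hs : 0 < s) : 0 < 1 - Real.exp (-(2 * s)) := by
  rw [sub_pos, Real.exp_lt_one_iff]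
  linarith

theorem errorConst_pos (hd : 0 < d) : 0 < errorConst d := by
  have := one_sub_exp_neg_two_mul_pos (s := √(π * d / 2)) (by positivity)
  unfold errorConst
  positivity

theorem tendsto_errorConst_nhdsGT_zero : Tendsto errorConst (𝓝[>] 0) atTop := by
  have continuous_root : Continuous fun d : ℝ => √√(2 * π * d) := by fun_prop
  have tendsto_root : Tendsto (fun d : ℝ => √√(2 * π * d)) (𝓝[>] 0) (𝓝[>] 0) := by
    refine tendsto_nhdsWithin_iff.2 ⟨?_, ?_⟩
    · simpa using (continuous_root.tendsto 0).mono_left nhdsWithin_le_nhds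
    · filter_upwards [self_mem_nhdsWithin] with d (hd : 0 < d)
      exact Set.mem_Ioi.2 (by positivity)
  refine tendsto_atTop_mono' _ ?_
    ((tendsto_inv_nhdsGT_zero.comp tendsto_root).const_mul_atTop (by norm_num : (0 : ℝ) < 8))
  filter_upwards [self_mem_nhdsWithin] with d (hd : 0 < d)
  have := one_sub_exp_neg_two_mul_pos (s := √(π * d / 2)) (by positivity)
  simp only [errorConst, Function.comp_apply, ← div_eq_mul_inv]
  exact le_add_of_nonneg_left (by positivity)

theorem inv_sinh_le_of_le {s₀ s : ℝ} (hs₀ : 0 < s₀) (hs : s₀ ≤ s) :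
    (Real.sinh s)⁻¹ ≤ 2 * Real.exp (-s) / (1 - Real.exp (-(2 * s₀))) := by
  have exp_le : Real.exp (-(2 * s)) ≤ Real.exp (-(2 * s₀)) := Real.exp_le_exp.2 (by linarith)
  have sinh_eq : Real.sinh s = Real.exp s * (1 - Real.exp (-(2 * s))) / 2 := by
    rw [Real.sinh_eq, mul_sub, ← Real.exp_add]
    ring_nf
  have := one_sub_exp_neg_two_mul_pos hs₀
  rw [sinh_eq, inv_div, Real.exp_neg s, ← div_eq_mul_inv, div_div]
  gcongr

theorem mul_sqrt_two_pi_mul_div (hK : 0 < K) (d : ℝ) :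
    K * √(2 * π * d / K) / 2 = √(π * d * K / 2) := by
  have radicand_eq : π * d * K / 2 = (K / 2) ^ 2 * (2 * π * d / K) := by
    field_simp
  rw [radicand_eq, Real.sqrt_mul (by positivity), Real.sqrt_sq (by positivity)]
  ring

theorem pi_mul_div_sqrt (hd : 0 < d) (hK : 0 < K) :
    π * d / √(2 * π * d / K) = √(π * d * K / 2) := by
  rw [← mul_sqrt_two_pi_mul_div hK, div_eq_div_iff (by positivity) two_ne_zero, mul_assoc _ √_,
    Real.mul_self_sqrt (by positivity)]
  field_simp

theorem rpow_one_div_four_eq_sqrt_sqrt (hK : 0 ≤ K) : K ^ (1 / 4 : ℝ) = √√K := by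
  rw [Real.sqrt_eq_rpow, Real.sqrt_eq_rpow, ← Real.rpow_mul hK]
  norm_num

theorem error_le_errorConst_mul {C N θ : ℝ} (hd : 0 < d) (hC : 0 ≤ C) (hN : 0 ≤ N) (hK : 1 ≤ K)
    (hθ : θ = √(2 * π * d / K)) :
    (Real.sinh (π * d / θ))⁻¹ * (2 * N) + 8 * C * Real.exp (-(K * θ / 2)) / √θ ≤
      errorConst d * √√K * Real.exp (-√(π * d * K / 2)) * (N + C) := by
  have hK₀ : 0 < K := one_pos.trans_le hK
  have sqrt_θ : √θ = √√(2 * π * d) / √√K := by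
    rw [hθ, Real.sqrt_div (by positivity), Real.sqrt_div (Real.sqrt_nonneg _)]
  have sqrt_le : √(π * d / 2) ≤ √(π * d * K / 2) :=
    Real.sqrt_le_sqrt (div_le_div_of_nonneg_right
      (le_mul_of_one_le_right (by positivity) hK) zero_le_two)
  have inv_sinh_le := inv_sinh_le_of_le (by positivity) sqrt_le
  have one_le_root : 1 ≤ √√K := Real.one_le_sqrt.2 (Real.one_le_sqrt.2 hK)
  have denom_pos := one_sub_exp_neg_two_mul_pos (s := √(π * d / 2)) (by positivity)
  rw [sqrt_θ, hθ, mul_sqrt_two_pi_mul_div hK₀, pi_mul_div_sqrt hd hK₀, errorConst]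
  set E := Real.exp (-√(π * d * K / 2))
  set A := 1 - Real.exp (-(2 * √(π * d / 2)))
  set B := √√(2 * π * d)
  have hB : 0 < B := by positivity
  calc (Real.sinh √(π * d * K / 2))⁻¹ * (2 * N) + 8 * C * E / (B / √√K)
      ≤ 2 * E / A * (2 * N) + 8 * C * E / (B / √√K) := by gcongr
    _ = 4 / A * 1 * E * N + 8 / B * √√K * E * C := by field_simp; ring
    _ ≤ 4 / A * √√K * E * (N + C) + 8 / B * √√K * E * (N + C) := by
        gcongr
        · exact le_add_of_nonneg_right hC
        · exact le_add_of_nonneg_left hN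
    _ = (4 / A + 8 / B) * √√K * E * (N + C) := by ring

end Constants

end SincApprox

theorem theoremC2 :
    ∃ Cd : ℝ → ℝ,
      (∀ d ∈ Set.Ioo (0 : ℝ) (Real.pi / 2), 0 < Cd d) ∧
      Filter.Tendsto Cd (nhdsWithin 0 (Set.Ioi 0)) Filter.atTop ∧
      ∀ (X : Type*) [NormedAddCommGroup X] [InnerProductSpace ℂ X] [CompleteSpace X]
        (d : ℝ), d ∈ Set.Ioo (0 : ℝ) (Real.pi / 2) →
        ∀ (F : ℂ → X), SincApprox.MemHardy 2 d F →
        ∀ C : ℝ, 0 < C → (∀ x : ℝ, ‖F (x : ℂ)‖ ≤ C / √(1 + x ^ 2)) →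
        ∀ K : ℕ, 1 ≤ K → ∀ θ : ℝ, θ = (2 * Real.pi * d / (K : ℝ)) ^ (1 / 2 : ℝ) →
          MeasureTheory.MemLp (fun x : ℝ => F (x : ℂ) - SincApprox.interpolant θ K F x) 2
            MeasureTheory.volume ∧
          MeasureTheory.eLpNorm (fun x : ℝ => F (x : ℂ) - SincApprox.interpolant θ K F x) 2
            MeasureTheory.volume ≤
          ENNReal.ofReal
            (Cd d * (K : ℝ) ^ (1 / 4 : ℝ) * Real.exp (-√(Real.pi * d * (K : ℝ) / 2)) *
              ((SincApprox.hardyNorm 2 d F).toReal + C)) := by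
  refine ⟨SincApprox.errorConst, fun d hd => SincApprox.errorConst_pos hd.1,
    SincApprox.tendsto_errorConst_nhdsGT_zero, ?_⟩
  intro X _ _ _ d ⟨hd₀, hd⟩ F hF C hC decay K hK θ hθ
  have one_le_K : (1 : ℝ) ≤ K := by exact_mod_cast hK
  rw [← Real.sqrt_eq_rpow] at hθ
  have θ_pos : 0 < θ := hθ ▸ by positivity
  have continuous_F : Continuous fun x : ℝ => F x :=
    hF.1.continuousOn.comp_continuous Complex.continuous_ofReal
      (SincApprox.ofReal_mem_domain hd₀ hd.le)
  have bound := (SincApprox.eLpNorm_sub_interpolant_le hd₀ hd.le θ_pos hF decay K).trans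
    (ENNReal.ofReal_le_ofReal
      (SincApprox.error_le_errorConst_mul hd₀ hC.le ENNReal.toReal_nonneg one_le_K hθ))
  rw [← SincApprox.rpow_one_div_four_eq_sqrt_sqrt K.cast_nonneg] at bound
  exact ⟨⟨(continuous_F.sub (SincApprox.continuous_interpolant θ K F)).aestronglyMeasurable,
    bound.trans_lt ENNReal.ofReal_lt_top⟩, bound⟩
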